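/- Let $n\ge 2$ and let $f=\sigma_2^{1/2}$ on the cone $\Gamma_2=\{\lambda\in\mathbb{R}^n:\sigma_1(\lambda)>0,\ \sigma_2(\lambda)>0\}$, where $\sigma_k$ is the $k$-th elementary symmetric function. For a real symmetric $n\times n$ matrix $A$ with eigenvalues $\lambda(A)\in\Gamma_2$ put $F(A)=f(\lambda(A))$, $F^{ij}=\partial F/\partial A_{ij}$, and let $\mathcal{M}$ be the set of all (positive definite, symmetric) matrices $M=\{F^{ij}(T)\}$, where $T$ is symmetric with $\lambda(T)\in\Gamma_2$. With $\delta(u,x,y)=u(x+y)+u(x-y)-2u(x)$ define, for $0<s<1$ and $\theta>0$, the extended-real-valued operators $$F_s[u](x)=\inf_{M\in\mathcal{M}}\ \frac12\int_{\mathbb{R}^n}\frac{\delta(u,x,y)}{|\sqrt{M}^{-1}y|^{n+2s}}\det\sqrt{M}^{-1}\,dy,$$ $$F_s^\theta[u](x)=\inf_{M\in\mathcal{M},\ \lambda_{\min}(M)\ge\theta}\ \frac12\int_{\mathbb{R}^n}\frac{\delta(u,x,y)}{|\sqrt{M}^{-1}y|^{n+2s}}\det\sqrt{M}^{-1}\,dy.$$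 **Theorem.** Let $\frac12<s<1$, $\eta_0>0$, $L\ge0$ and $SC\ge 0$. There is a constant $\theta>0$, depending only on $n$, $\eta_0$, $s$, $L$ and $SC$, with the following property. Let $\Omega\subset\mathbb{R}^n$ be open and let $u:\mathbb{R}^n\to\mathbb{R}$ be Lipschitz continuous with constant $L$ and semi-concave with constant $SC$, that is, $\delta(u,x,y)\le SC\,|y|^2$ for all $x,y\in\mathbb{R}^n$. Suppose that $(1-s)F_s[u]\ge\eta_0$ in $\Omega$ in the viscosity sense: whenever $x\in\Omega$, $N\subset\Omega$ is an open neighborhood of $x$, $\psi$ is $C^2$ in $\overline N$, $\psi(x)=u(x)$ and $\psi>u$ in $N\setminus\{x\}$, the function $v$ equal to $\psi$ in $N$ and to $u$ in $\mathbb{R}^n\setminus N$ satisfies $(1-s)F_s[v](x)\ge\eta_0$. Then $$F_s[u](x)=F_s^\theta[u](x)\qquad\text{for all }x\in\Omega.$$ -/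

import Mathlib

open MeasureTheory
open scoped NNReal ENNReal MatrixOrder

noncomputable section

namespace FracHessian

/-- The Euclidean space `ℝⁿ`. -/
abbrev E (n : ℕ) : Type := EuclideanSpace ℝ (Fin n)

/-! ### The fully nonlinear function `f` and its set of linearized coefficients -/

/-- The `k`-th elementary symmetric function `σ_k(λ)`. -/
def sigma {n : ℕ} (k : ℕ) (l : Fin n → ℝ) : ℝ :=
  ∑ t ∈ Finset.powersetCard k (Finset.univ : Finset (Fin n)), ∏ i ∈ t, l i

/-- The Garding cone `Γ_k = {λ : σ_j(λ) > 0, j = 1, …, k}`. -/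
def GammaCone (n k : ℕ) : Set (Fin n → ℝ) :=
  {l | ∀ j, 1 ≤ j → j ≤ k → 0 < sigma j l}

/-- The function `σ_k^{1/k}`. -/
def sigmaRoot (n k : ℕ) (l : Fin n → ℝ) : ℝ := sigma k l ^ (1 / (k : ℝ))

open Classical in
/-- The vector `λ(A)` of eigenvalues (with multiplicity) of a real symmetric matrix `A`.
Only used for symmetric `A`. -/
def eigenvals {n : ℕ} (A : Matrix (Fin n) (Fin n) ℝ) : Fin n → ℝ :=
  if h : A.IsHermitian then h.eigenvalues else 0

/-- The smallest eigenvalue of a real symmetric matrix. -/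
def lambdaMin {n : ℕ} (A : Matrix (Fin n) (Fin n) ℝ) : ℝ := ⨅ i, eigenvals A i

/-- The matrix function `F(A) = f(λ(A))`. -/
def spectralFun {n : ℕ} (f : (Fin n → ℝ) → ℝ) (A : Matrix (Fin n) (Fin n) ℝ) : ℝ :=
  f (eigenvals A)

/-- `M = {F^{ij}(T)}`: the symmetric matrix `M` is the gradient at the symmetric matrix `T` of
`F = f ∘ λ` on the space of symmetric matrices, i.e. the derivative of `F` at `T` in any symmetric
direction `H` is `∑ M^{ij} H_{ij} = trace (M H)`. -/
def IsSpectralGradient {n : ℕ} (f : (Fin n → ℝ) → ℝ) (T M : Matrix (Fin n) (Fin n) ℝ) : Prop :=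
  M.IsSymm ∧ ∀ H : Matrix (Fin n) (Fin n) ℝ, H.IsSymm →
    HasDerivAt (fun t : ℝ => spectralFun f (T + t • H)) (M * H).trace 0

/-- The set `𝓜` of positive definite symmetric matrices `M` of the form `M = {F^{ij}(T)}` for a
symmetric matrix `T` with `λ(T) ∈ Γ`. -/
def coeffSet {n : ℕ} (f : (Fin n → ℝ) → ℝ) (Γ : Set (Fin n → ℝ)) :
    Set (Matrix (Fin n) (Fin n) ℝ) :=
  {M | M.PosDef ∧ ∃ T : Matrix (Fin n) (Fin n) ℝ,
    T.IsSymm ∧ eigenvals T ∈ Γ ∧ IsSpectralGradient f T M}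

/-! ### The fractional operators -/

/-- The second difference `δ(u, x, y) = u(x + y) + u(x - y) - 2 u(x)`. -/
def secondDiff {n : ℕ} (u : E n → ℝ) (x y : E n) : ℝ := u (x + y) + u (x - y) - 2 * u x

/-- The extended-real-valued Lebesgue integral `∫ g⁺ - ∫ g⁻` over `ℝⁿ`. It agrees with the usual
integral if `g` is integrable, and it is the standard value `±∞` if exactly one of `∫ g⁺`, `∫ g⁻`
is infinite (the value is `-∞` by convention if both are). -/
def extIntegral {n : ℕ} (g : E n → ℝ) : EReal :=
  ((∫⁻ y, ENNReal.ofReal (g y) : ℝ≥0∞) : EReal) - ((∫⁻ y, ENNReal.ofReal (-g y) : ℝ≥0∞) : EReal)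

/-- The linear operator with coefficient matrix `M`:
`(1/2) ∫ δ(u, x, y) / |√M⁻¹ y|^{n+2s} · det √M⁻¹ dy`. -/
def linearOp {n : ℕ} (s : ℝ) (M : Matrix (Fin n) (Fin n) ℝ) (u : E n → ℝ) (x : E n) : EReal :=
  extIntegral fun y =>
    1 / 2 * (secondDiff u x y / ‖Matrix.toEuclideanLin (CFC.sqrt M)⁻¹ y‖ ^ ((n : ℝ) + 2 * s)
      * ((CFC.sqrt M)⁻¹).det)

/-- The fractional Hessian operator `F_s[u](x)`, the infimum of the linear operators with
coefficients in `𝓜`. -/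
def fracHessian {n : ℕ} (f : (Fin n → ℝ) → ℝ) (Γ : Set (Fin n → ℝ)) (s : ℝ)
    (u : E n → ℝ) (x : E n) : EReal :=
  ⨅ M ∈ coeffSet f Γ, linearOp s M u x

/-- The strictly elliptic operator `F_s^θ[u](x)`: the infimum is restricted to the `M ∈ 𝓜` with
`λ_min(M) ≥ θ`. -/
def fracHessianElliptic {n : ℕ} (f : (Fin n → ℝ) → ℝ) (Γ : Set (Fin n → ℝ)) (s θ : ℝ)
    (u : E n → ℝ) (x : E n) : EReal :=
  ⨅ M ∈ {M | M ∈ coeffSet f Γ ∧ θ ≤ lambdaMin M}, linearOp s M u x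

/-! ### Semi-concavity and viscosity inequalities -/

/-- `u` is semi-concave in the set `A` with semi-concavity constant `SC`. -/
def IsSemiconcaveOn {n : ℕ} (A : Set (E n)) (SC : ℝ) (u : E n → ℝ) : Prop :=
  ContinuousOn u A ∧ 0 ≤ SC ∧
    ∀ x y : E n, segment ℝ (x - y) (x + y) ⊆ A → secondDiff u x y ≤ SC * ‖y‖ ^ 2

open Classical in
/-- `G[u] ≥ g` in `Ω` in the viscosity sense, for a nonlocal operator `G`: whenever a `C²` function
`ψ` on (the closure of) an open neighborhood `N ⊆ Ω` of `x` touches `u` strictly from above at `x`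
in `N`, the function `v` equal to `ψ` in `N` and to `u` elsewhere satisfies `G[v](x) ≥ g(x)`. -/
def IsViscositySubsolution {n : ℕ} (G : (E n → ℝ) → E n → EReal) (g : E n → ℝ)
    (Ω : Set (E n)) (u : E n → ℝ) : Prop :=
  UpperSemicontinuousOn u (closure Ω) ∧
    ∀ x ∈ Ω, ∀ N : Set (E n), IsOpen N → x ∈ N → N ⊆ Ω →
      ∀ ψ : E n → ℝ, ContDiffOn ℝ 2 ψ (closure N) → ψ x = u x →
        (∀ y ∈ N, y ≠ x → u y < ψ y) →
          (g x : EReal) ≤ G (fun y => if y ∈ N then ψ y else u y) x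

end FracHessian

end

/-!
The matrices `M` of `𝓜` are exactly the positive definite ones with
`(tr M)² / (n - 1) - tr M² = 1/2` (`mem_coeffSet_iff`). Hence, if one eigenvalue `ε` of `M` is small,
the others are all close to their mean `R`, and `4 R ε ≥ 1`
(`eigenvalues_near_mean_of_constraint`): degenerate coefficients are large, and almost round, on a
hyperplane.

Diagonalizing `M = U diag(m) Uᵀ` and substituting `y = U diag(√m) w` turns the linear operator into
`∫ ½ δ(v, 0, √m w) / |w|^{n+2s} dw` with `v = u (x + U ·)` (`linearOp_conjDiag`), so that operators
with the same eigenvectors can be compared. The key estimate (`integral_stretchIntegrand_le`) says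
that enlarging the eigenvalues from `a` to `b` raises the operator by at most
`c ∑ (bᵢ - aᵢ)^s`, with `c` depending only on `n`, `s`, `L`, `SC`. It is obtained one coordinate at a
time: after symmetrization in that coordinate only the even part of `u` along a line matters, and
semi-concavity and the Lipschitz bound control its growth by `min (SC r²) (2 L r)`, which is
integrable against `|w|^{-n-2s}` because `1/2 < s < 1`.

A semi-concave function is touched from above by a paraboloid at every point. Using paraboloids on
shrinking balls as test functions, with Fatou's lemma, the viscosity inequality becomes the pointwise
bound `L_M u ≥ η := η₀ / (1 - s)` for every `M ∈ 𝓜` (`integral_stretchIntegrand_ge_of_viscosity`).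

Finally, fix `(R₁, …, R₁, ε₁)` in `𝓜` with `ε₁` so small that `c ε₁^s ≤ η / 2`. A matrix `M ∈ 𝓜` with
smallest eigenvalue below `θ` lies below a large multiple `t (R₁, …, R₁, ε₁)` in its own eigenbasis,
and the comparison gives `L_M u ≥ t^s η / 4` once `θ` is small
(`exists_degenerate_threshold`). Since `t → ∞` as `θ → 0`, this exceeds the value, bounded in terms of
`L` and `SC`, of the operator whose coefficient matrix is the multiple of the identity in `𝓜`.
Matrices with `λ_min(M) < θ` therefore do not affect the infimum.
-/

noncomputable section

namespace FracHessian

/-! ### Semi-concave functions -/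

/-- A continuous midpoint concave function is concave. -/
theorem concaveOn_of_midpoint {V : Type*} [AddCommGroup V] [Module ℝ V] [TopologicalSpace V]
    [IsTopologicalAddGroup V] [ContinuousSMul ℝ V] {f : V → ℝ} (hf : Continuous f)
    (hmid : ∀ x h, f (x + h) + f (x - h) ≤ 2 * f x) : ConcaveOn ℝ Set.univ f := by
  refine ⟨convex_univ, fun x _ y _ a b ha hb hab => ?_⟩
  obtain rfl : a = 1 - b := by linarith
  set φ : ℝ → ℝ := fun t => f (x + t • (y - x)) - (1 - t) * f x - t * f y with hφ
  have hφc : Continuous φ := by fun_prop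
  have hφmid : ∀ t h, φ (t + h) + φ (t - h) ≤ 2 * φ t := by
    intro t h
    have := hmid (x + t • (y - x)) (h • (y - x))
    have e1 : x + t • (y - x) + h • (y - x) = x + (t + h) • (y - x) := by module
    have e2 : x + t • (y - x) - h • (y - x) = x + (t - h) • (y - x) := by module
    rw [e1, e2] at this
    simp only [hφ]
    linarith
  have h0 : φ 0 = 0 := by simp [hφ]
  have h1 : φ 1 = 0 := by simp [hφ]
  obtain ⟨t₀, ht₀, hmin⟩ := isCompact_Icc.exists_isMinOn (Set.nonempty_Icc.2 zero_le_one)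
    (hφc.continuousOn (s := Set.Icc (0 : ℝ) 1))
  have hnonneg : 0 ≤ φ t₀ := by
    by_contra! hneg
    have hK : IsCompact (Set.Icc (0 : ℝ) 1 ∩ {t | φ t = φ t₀}) :=
      isCompact_Icc.inter_right (isClosed_eq hφc continuous_const)
    -- At the largest minimizer the midpoint inequality fails.
    obtain ⟨t, ⟨ht, htm⟩, hgr⟩ := hK.exists_isGreatest ⟨t₀, ht₀, rfl⟩
    simp only [Set.mem_ofPred_eq] at htm
    have ht0 : 0 < t := lt_of_le_of_ne ht.1 (by rintro rfl; linarith)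
    have ht1 : t < 1 := lt_of_le_of_ne ht.2 (by rintro rfl; linarith)
    set h := min t (1 - t) with hh
    have hpos : 0 < h := lt_min ht0 (by linarith)
    have hl : h ≤ t := min_le_left _ _
    have hr : h ≤ 1 - t := min_le_right _ _
    have m1 : φ t₀ ≤ φ (t - h) := hmin ⟨by linarith, by linarith⟩
    have m2 : φ t₀ ≤ φ (t + h) := hmin ⟨by linarith, by linarith⟩
    have m3 : φ (t + h) ≠ φ t₀ := fun e => by
      have := hgr ⟨⟨by linarith, by linarith⟩, e⟩
      linarith
    have m4 := lt_of_le_of_ne m2 m3.symm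
    have := hφmid t h
    linarith
  have hb1 : 0 ≤ φ b := hnonneg.trans (hmin ⟨hb, by linarith⟩)
  have e : x + b • (y - x) = (1 - b) • x + b • y := by module
  simp only [hφ, e] at hb1
  simp only [smul_eq_mul]
  linarith

/-- A continuous concave function has a supergradient at every point, by separating the point of
the graph from the open convex strict hypograph. -/
theorem exists_supergradient {V : Type*} [NormedAddCommGroup V] [NormedSpace ℝ V] {f : V → ℝ}
    (hf : Continuous f) (hc : ConcaveOn ℝ Set.univ f) (x : V) :
    ∃ p : V →L[ℝ] ℝ, ∀ y, f y ≤ f x + p (y - x) := by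
  have hconv : Convex ℝ {q : V × ℝ | q.2 < f q.1} := by
    simpa using hc.convex_strict_hypograph
  have hopen : IsOpen {q : V × ℝ | q.2 < f q.1} :=
    isOpen_lt continuous_snd (hf.comp continuous_fst)
  obtain ⟨l, hl⟩ := geometric_hahn_banach_open_point hconv hopen (x := (x, f x)) (by simp)
  have hsplit : ∀ y t, l (y, t) = l (y, 0) + t * l (0, 1) := by
    intro y t
    have : ((y, t) : V × ℝ) = (y, 0) + t • (0, 1) := by simp
    rw [this, map_add, map_smul, smul_eq_mul]
  set c := l (0, 1)
  have hcpos : 0 < c := by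
    have := hl (x, f x - 1) (by simp)
    rw [hsplit, hsplit x (f x)] at this
    linarith
  refine ⟨-(c⁻¹ • l.comp (ContinuousLinearMap.inl ℝ V ℝ)), fun y => ?_⟩
  refine le_of_forall_pos_lt_add fun e he => ?_
  have := hl (y, f y - e) (by simp [he])
  rw [hsplit, hsplit x (f x)] at this
  have e1 : l (y - x, 0) = l (y, 0) - l (x, 0) := by
    rw [← map_sub]; simp
  simp only [neg_apply, smul_apply,
    ContinuousLinearMap.comp_apply, ContinuousLinearMap.inl_apply, smul_eq_mul, e1]
  have h2 : c * (f y - f x - e) < l (x, 0) - l (y, 0) := by linarith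
  have h3 : f y - f x - e < c⁻¹ * (l (x, 0) - l (y, 0)) := by
    rw [inv_mul_eq_div, lt_div_iff₀ hcpos]; linarith
  linarith

/-- Along a line, the even part of a Lipschitz semi-concave function grows at most like
`min (C r²) (2 K r)`: after subtracting `C t²`, it is an even concave function of `t`, hence
nonincreasing for `t ≥ 0`. -/
theorem even_part_le {V : Type*} [NormedAddCommGroup V] [NormedSpace ℝ V] {u : V → ℝ}
    {K : ℝ≥0} {C : ℝ} (hu : LipschitzWith K u)
    (hsc : ∀ x h, u (x + h) + u (x - h) - 2 * u x ≤ C * ‖h‖ ^ 2) (p e : V) (he : ‖e‖ = 1)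
    {α β : ℝ} (hα : 0 ≤ α) (hαβ : α ≤ β) :
    u (p + β • e) + u (p - β • e) ≤ u (p + α • e) + u (p - α • e) +
      min (C * (β ^ 2 - α ^ 2)) (2 * K * (β - α)) := by
  have huc := hu.continuous
  rw [← min_add_add_left]
  refine le_min ?_ ?_
  · set ψ : ℝ → ℝ := fun t => u (p + t • e) + u (p - t • e) - C * t ^ 2 with hψ
    have hc : ConcaveOn ℝ Set.univ ψ := by
      refine concaveOn_of_midpoint (by fun_prop) fun t h => ?_
      have h1 := hsc (p + t • e) (h • e)
      have h2 := hsc (p - t • e) (h • e)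
      rw [norm_smul, he, mul_one, Real.norm_eq_abs, sq_abs] at h1 h2
      have e1 : p + t • e + h • e = p + (t + h) • e := by module
      have e2 : p + t • e - h • e = p + (t - h) • e := by module
      have e3 : p - t • e + h • e = p - (t - h) • e := by module
      have e4 : p - t • e - h • e = p - (t + h) • e := by module
      rw [e1, e2] at h1
      rw [e3, e4] at h2
      simp only [hψ]
      nlinarith
    rcases hαβ.eq_or_lt with rfl | hlt
    · simp
    have hβ : 0 < β := hα.trans_lt hlt
    have heven : ψ (-β) = ψ β := by
      simp only [hψ, neg_smul, sub_neg_eq_add, neg_sq, ← sub_eq_add_neg]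
      rw [add_comm (u _)]
    have e1 : (β - α) / (2 * β) + (β + α) / (2 * β) = 1 := by field_simp; ring
    have w1 : 0 ≤ (β - α) / (2 * β) := div_nonneg (by linarith) (by linarith)
    have w2 : 0 ≤ (β + α) / (2 * β) := div_nonneg (by linarith) (by linarith)
    have hc' := hc.2 (Set.mem_univ (-β)) (Set.mem_univ β) w1 w2 e1
    rw [heven, ← add_smul] at hc'
    have e2 : ((β - α) / (2 * β)) • (-β) + ((β + α) / (2 * β)) • β = α := by
      simp only [smul_eq_mul]; field_simp; ring
    rw [e1, e2, one_smul] at hc'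
    simp only [hψ] at hc'
    linarith
  · have h1 : u (p + β • e) - u (p + α • e) ≤ K * (β - α) := by
      have := (le_abs_self _).trans ((hu.dist_le_mul (p + β • e) (p + α • e)))
      rwa [dist_eq_norm, show p + β • e - (p + α • e) = (β - α) • e by module, norm_smul, he,
        mul_one, Real.norm_of_nonneg (by linarith)] at this
    have h2 : u (p - β • e) - u (p - α • e) ≤ K * (β - α) := by
      have := (le_abs_self _).trans ((hu.dist_le_mul (p - β • e) (p - α • e)))
      rwa [dist_eq_norm, show p - β • e - (p - α • e) = (α - β) • e by module, norm_smul, he,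
        mul_one, Real.norm_of_nonpos (by linarith), neg_sub] at this
    linarith

/-! ### Growth of second differences and the kernel -/

/-- The bound `min (C r²) (2 L r)` for second differences at distance `r` of functions that are
`L`-Lipschitz and semi-concave with constant `C`. -/
def growth (C L r : ℝ) : ℝ := min (C * r ^ 2) (2 * L * r)

theorem growth_nonneg {C L r : ℝ} (hC : 0 ≤ C) (hL : 0 ≤ L) (hr : 0 ≤ r) : 0 ≤ growth C L r :=
  le_min (by positivity) (by positivity)

theorem continuous_growth (C L : ℝ) : Continuous (growth C L) := by
  unfold growth; fun_prop

theorem secondDiff_le_growth {n : ℕ} {u : E n → ℝ} {L : ℝ≥0} {C : ℝ} (hu : LipschitzWith L u)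
    (hsc : ∀ x y, secondDiff u x y ≤ C * ‖y‖ ^ 2) (x y : E n) :
    secondDiff u x y ≤ growth C L ‖y‖ := by
  refine le_min (hsc x y) ?_
  have h1 := (le_abs_self _).trans (hu.dist_le_mul (x + y) x)
  have h2 := (le_abs_self _).trans (hu.dist_le_mul (x - y) x)
  simp only [dist_eq_norm, add_sub_cancel_left, sub_sub_cancel_left, norm_neg] at h1 h2
  unfold secondDiff
  linarith

theorem integrableOn_growth_mul_rpow {s : ℝ} (hs₀ : 1 / 2 < s) (hs₁ : s < 1) {C L : ℝ}
    (hC : 0 ≤ C) (hL : 0 ≤ L) :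
    IntegrableOn (fun r : ℝ => growth C L r * r ^ (-1 - 2 * s)) (Set.Ioi 0) := by
  have hmeas : Measurable (fun r : ℝ => growth C L r * r ^ (-1 - 2 * s)) :=
    (continuous_growth C L).measurable.mul (measurable_id.pow_const _)
  have key : ∀ r : ℝ, 0 < r → ‖growth C L r * r ^ (-1 - 2 * s)‖ ≤ C * r ^ (1 - 2 * s) ∧
      ‖growth C L r * r ^ (-1 - 2 * s)‖ ≤ 2 * L * r ^ (-2 * s) := by
    intro r hr
    have hp : 0 ≤ r ^ (-1 - 2 * s) := Real.rpow_nonneg hr.le _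
    have e1 : r ^ (1 - 2 * s) = r ^ 2 * r ^ (-1 - 2 * s) := by
      rw [← Real.rpow_natCast, ← Real.rpow_add hr]; congr 1; push_cast; ring
    have e2 : r ^ (-2 * s) = r * r ^ (-1 - 2 * s) := by
      rw [← Real.rpow_one_add' hr.le (by linarith)]; congr 1; ring
    rw [Real.norm_of_nonneg (mul_nonneg (growth_nonneg hC hL hr.le) hp), e1, e2, ← mul_assoc,
      ← mul_assoc]
    exact ⟨mul_le_mul_of_nonneg_right (min_le_left _ _) hp,
      mul_le_mul_of_nonneg_right (min_le_right _ _) hp⟩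
  rw [← Set.Ioc_union_Ioi_eq_Ioi zero_le_one]
  refine IntegrableOn.union ?_ ?_
  · have h1 : IntegrableOn (fun r : ℝ => C * r ^ (1 - 2 * s)) (Set.Ioc 0 1) := by
      rw [integrableOn_Ioc_iff_integrableOn_Ioo]
      exact ((intervalIntegral.integrableOn_Ioo_rpow_iff one_pos).2 (by linarith)).const_mul C
    refine h1.mono' hmeas.aestronglyMeasurable ?_
    filter_upwards [ae_restrict_mem measurableSet_Ioc] with r hr using (key r hr.1).1
  · have h1 : IntegrableOn (fun r : ℝ => 2 * L * r ^ (-2 * s)) (Set.Ioi 1) :=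
      ((integrableOn_Ioi_rpow_iff one_pos).2 (by linarith)).const_mul _
    refine h1.mono' hmeas.aestronglyMeasurable ?_
    filter_upwards [ae_restrict_mem measurableSet_Ioi] with r hr
      using (key r (one_pos.trans hr)).2

theorem integrable_growth {n : ℕ} (hn : 0 < n) {s : ℝ} (hs₀ : 1 / 2 < s) (hs₁ : s < 1) {C L : ℝ}
    (hC : 0 ≤ C) (hL : 0 ≤ L) :
    Integrable (fun w : E n => growth C L ‖w‖ / ‖w‖ ^ ((n : ℝ) + 2 * s)) := by
  have : Nonempty (Fin n) := ⟨⟨0, hn⟩⟩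
  rw [integrable_fun_norm_addHaar (volume : Measure (E n))
    (f := fun r => growth C L r / r ^ ((n : ℝ) + 2 * s))]
  refine (integrableOn_growth_mul_rpow hs₀ hs₁ hC hL).congr_fun (fun r hr => ?_) measurableSet_Ioi
  have hr : 0 < r := hr
  have e : r ^ (-1 - 2 * s) = r ^ (n - 1) / r ^ ((n : ℝ) + 2 * s) := by
    rw [← Real.rpow_natCast, ← Real.rpow_sub hr]
    congr 1
    rw [Nat.cast_sub (by omega : 1 ≤ n)]
    push_cast; ring
  simp only [finrank_euclideanSpace_fin, smul_eq_mul, e]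
  ring

/-- The constant `c` of the comparison estimate, the integral of the growth bound against the kernel
`|w|^{-n-2s}`. -/
def growthConst (n : ℕ) (s C L : ℝ) : ℝ :=
  ∫ w : E n, growth C L ‖w‖ / ‖w‖ ^ ((n : ℝ) + 2 * s)

theorem growthConst_nonneg {n : ℕ} {s C L : ℝ} (hC : 0 ≤ C) (hL : 0 ≤ L) :
    0 ≤ growthConst n s C L :=
  integral_nonneg fun w => div_nonneg (growth_nonneg hC hL (norm_nonneg w)) (by positivity)

/-- Rescaling of the kernel `‖w‖ ^ (-p)`. At `w = 0` both sides may be divisions by zero, and then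
both vanish. -/
theorem eq_mul_comp_smul {n : ℕ} (p : ℝ) (φ : E n → ℝ) {r : ℝ} (hr : 0 < r) (w : E n) :
    φ (r • w) / ‖w‖ ^ p = r ^ p * (φ (r • w) / ‖r • w‖ ^ p) := by
  rw [norm_smul, Real.norm_of_nonneg hr.le, Real.mul_rpow hr.le (norm_nonneg w)]
  have := (Real.rpow_pos_of_pos hr p).ne'
  by_cases h : ‖w‖ ^ p = 0
  · simp [h]
  · field_simp

theorem integrable_comp_smul_div {n : ℕ} {p : ℝ} {φ : E n → ℝ} {r : ℝ} (hr : 0 < r)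
    (hφ : Integrable fun w => φ w / ‖w‖ ^ p) : Integrable fun w => φ (r • w) / ‖w‖ ^ p := by
  simp_rw [eq_mul_comp_smul p φ hr]
  exact (hφ.comp_smul hr.ne').const_mul _

theorem integral_comp_smul_div {n : ℕ} {t : ℝ} (φ : E n → ℝ) {r : ℝ} (hr : 0 < r) :
    ∫ w, φ (r • w) / ‖w‖ ^ ((n : ℝ) + t) = r ^ t * ∫ w, φ w / ‖w‖ ^ ((n : ℝ) + t) := by
  simp_rw [eq_mul_comp_smul _ φ hr]
  rw [integral_const_mul,
    Measure.integral_comp_smul volume (fun w : E n => φ w / ‖w‖ ^ ((n : ℝ) + t)),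
    finrank_euclideanSpace_fin, abs_of_pos (by positivity), smul_eq_mul, ← mul_assoc,
    Real.rpow_add hr, Real.rpow_natCast]
  congr 1
  field_simp

theorem integrable_growth_mul {n : ℕ} (hn : 0 < n) {s : ℝ} (hs₀ : 1 / 2 < s) (hs₁ : s < 1)
    {C L : ℝ} (hC : 0 ≤ C) (hL : 0 ≤ L) {r : ℝ} (hr : 0 ≤ r) :
    Integrable (fun w : E n => growth C L (r * ‖w‖) / ‖w‖ ^ ((n : ℝ) + 2 * s)) := by
  rcases hr.eq_or_lt with rfl | hr
  · simp [growth]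
  · simpa [norm_smul, abs_of_pos hr] using
      integrable_comp_smul_div (φ := fun w : E n => growth C L ‖w‖) hr
        (integrable_growth hn hs₀ hs₁ hC hL)

theorem integral_growth_mul {n : ℕ} {s : ℝ} (hs₀ : 1 / 2 < s) {C L : ℝ} {r : ℝ} (hr : 0 ≤ r) :
    ∫ w : E n, growth C L (r * ‖w‖) / ‖w‖ ^ ((n : ℝ) + 2 * s)
      = r ^ (2 * s) * growthConst n s C L := by
  rcases hr.eq_or_lt with rfl | hr
  · simp [growth, Real.zero_rpow (show 2 * s ≠ 0 by linarith)]
  · simpa [norm_smul, abs_of_pos hr, growthConst] using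
      integral_comp_smul_div (t := 2 * s) (fun w : E n => growth C L ‖w‖) hr

/-! ### The operators in diagonalized coordinates -/

/-- The diagonal linear map `w ↦ (aᵢ wᵢ)ᵢ`. -/
def stretch {n : ℕ} (a : Fin n → ℝ) (w : E n) : E n := WithLp.toLp 2 fun i => a i * w i

/-- The integrand, in diagonalized coordinates, of the linear operator at the point `0`. The vector
`a` holds the square roots of the eigenvalues of the coefficient matrix. -/
def stretchIntegrand {n : ℕ} (s : ℝ) (v : E n → ℝ) (a : Fin n → ℝ) (w : E n) : ℝ :=
  1 / 2 * (secondDiff v 0 (stretch a w) / ‖w‖ ^ ((n : ℝ) + 2 * s))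

theorem continuous_stretch {n : ℕ} (a : Fin n → ℝ) : Continuous (stretch a) := by
  unfold stretch; fun_prop

theorem measurable_stretchIntegrand {n : ℕ} (s : ℝ) {v : E n → ℝ} (hv : Measurable v)
    (a : Fin n → ℝ) : Measurable (stretchIntegrand s v a) := by
  have := (continuous_stretch a).measurable
  unfold stretchIntegrand secondDiff
  fun_prop

/-- The reflection that changes the sign of the `i`-th coordinate. -/
def coordFlip {n : ℕ} (i : Fin n) : E n ≃ₗᵢ[ℝ] E n :=
  LinearIsometryEquiv.piLpCongrRight 2 fun j =>
    if j = i then LinearIsometryEquiv.neg ℝ else LinearIsometryEquiv.refl ℝ ℝ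

/-- Pointwise form of the comparison: if `a` and `b` differ only in the coordinate `i`, the second
differences are comparable after averaging over the reflection in that coordinate. The individual
second differences are not comparable. -/
theorem secondDiff_stretch_add_coordFlip_le {n : ℕ} {v : E n → ℝ} {L : ℝ≥0} {C : ℝ} (hC : 0 ≤ C)
    (hv : LipschitzWith L v) (hsc : ∀ x y, secondDiff v x y ≤ C * ‖y‖ ^ 2)
    {a b : Fin n → ℝ} {i : Fin n} (hj : ∀ j, j ≠ i → a j = b j) (ha : 0 ≤ a i)
    (hab : a i ≤ b i) (w : E n) :
    secondDiff v 0 (stretch b w) + secondDiff v 0 (stretch b (coordFlip i w)) ≤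
      secondDiff v 0 (stretch a w) + secondDiff v 0 (stretch a (coordFlip i w)) +
        2 * growth C L (√(b i ^ 2 - a i ^ 2) * ‖w‖) := by
  set e : E n := EuclideanSpace.single i 1 with he
  have hen : ‖e‖ = 1 := by simp [he]
  set p : E n := stretch (Function.update a i 0) w with hp
  have hstr : ∀ c : Fin n → ℝ, (∀ j, j ≠ i → a j = c j) →
      stretch c w = p + (c i * w i) • e ∧ stretch c (coordFlip i w) = p - (c i * w i) • e := by
    intro c hc
    constructor <;> ext j <;> by_cases h : j = i
    · subst h; simp [stretch, hp, he]
    · simp [stretch, hp, he, h, hc j h]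
    · subst h; simp [stretch, coordFlip, hp, he]
    · simp [stretch, coordFlip, hp, he, h, hc j h]
  have key : ∀ q : E n, v (q + (b i * w i) • e) + v (q - (b i * w i) • e) ≤
      v (q + (a i * w i) • e) + v (q - (a i * w i) • e) +
        growth C L (√(b i ^ 2 - a i ^ 2) * ‖w‖) := by
    intro q
    have hd : 0 ≤ b i ^ 2 - a i ^ 2 := by nlinarith
    have hwi : |w i| ≤ ‖w‖ := PiLp.norm_apply_le w i
    have h0 := even_part_le hv hsc q e hen (α := a i * |w i|) (β := b i * |w i|)
      (by positivity) (by gcongr)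
    have hbound : min (C * ((b i * |w i|) ^ 2 - (a i * |w i|) ^ 2))
        (2 * L * (b i * |w i| - a i * |w i|)) ≤ growth C L (√(b i ^ 2 - a i ^ 2) * ‖w‖) := by
      refine min_le_min ?_ ?_
      · rw [mul_pow, mul_pow, mul_pow, Real.sq_sqrt hd, ← sub_mul]
        gcongr
      · have h1 : b i - a i ≤ √(b i ^ 2 - a i ^ 2) := by
          apply Real.le_sqrt_of_sq_le; nlinarith
        rw [← sub_mul]
        gcongr
    have habs : ∀ c : ℝ, v (q + (c * |w i|) • e) + v (q - (c * |w i|) • e) =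
        v (q + (c * w i) • e) + v (q - (c * w i) • e) := by
      intro c
      rcases abs_choice (w i) with h | h <;> rw [h]
      rw [mul_neg, neg_smul, sub_neg_eq_add, ← sub_eq_add_neg, add_comm]
    rw [habs, habs] at h0
    linarith
  rw [(hstr b hj).1, (hstr b hj).2, (hstr a fun _ _ => rfl).1, (hstr a fun _ _ => rfl).2]
  have k1 := key p
  have k2 := key (-p)
  have r1 : ∀ t : ℝ, -(p + t • e) = -p - t • e := fun t => by module
  have r2 : ∀ t : ℝ, -(p - t • e) = -p + t • e := fun t => by module
  simp only [secondDiff, zero_add, zero_sub, r1, r2]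
  linarith

theorem stretchIntegrand_le {n : ℕ} (s : ℝ) {v : E n → ℝ} {C L : ℝ} (hC : 0 ≤ C) (hL : 0 ≤ L)
    (hv : ∀ y, secondDiff v 0 y ≤ growth C L ‖y‖)
    {a : Fin n → ℝ} {m : ℝ} (ha : ∀ i, |a i| ≤ m) (hm : 0 ≤ m) (w : E n) :
    stretchIntegrand s v a w ≤ growth C L (m * ‖w‖) / ‖w‖ ^ ((n : ℝ) + 2 * s) := by
  have h1 : ‖stretch a w‖ ≤ m * ‖w‖ := by
    refine le_of_sq_le_sq ?_ (by positivity)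
    rw [mul_pow, EuclideanSpace.norm_sq_eq, EuclideanSpace.norm_sq_eq, Finset.mul_sum]
    refine Finset.sum_le_sum fun i _ => ?_
    simp only [stretch, Real.norm_eq_abs, abs_mul, mul_pow]
    gcongr
    exact ha i
  have h2 : secondDiff v 0 (stretch a w) ≤ growth C L (m * ‖w‖) := by
    refine (hv _).trans ?_
    unfold growth
    gcongr
  have h3 : 0 ≤ growth C L (m * ‖w‖) := growth_nonneg hC hL (by positivity)
  have hp : 0 ≤ (‖w‖ ^ ((n : ℝ) + 2 * s))⁻¹ := by positivity
  unfold stretchIntegrand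
  rw [div_eq_mul_inv, div_eq_mul_inv, ← mul_assoc]
  exact mul_le_mul_of_nonneg_right (by linarith) hp

/-! ### Comparison of operators with common eigenvectors -/

/-- Comparison of two operators whose eigenvalues differ in one coordinate. -/
theorem integral_stretchIntegrand_coord_le {n : ℕ} (hn : 0 < n) {s : ℝ} (hs₀ : 1 / 2 < s)
    (hs₁ : s < 1) {v : E n → ℝ} {L : ℝ≥0} {C : ℝ} (hC : 0 ≤ C)
    (hv : LipschitzWith L v) (hsc : ∀ x y, secondDiff v x y ≤ C * ‖y‖ ^ 2)
    {a b : Fin n → ℝ} {i : Fin n} (hj : ∀ j, j ≠ i → a j = b j) (ha : 0 ≤ a i)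
    (hab : a i ≤ b i) (hb : Integrable (stretchIntegrand s v b)) :
    Integrable (stretchIntegrand s v a) ∧
      ∫ w, stretchIntegrand s v b w ≤ (∫ w, stretchIntegrand s v a w) +
        (b i ^ 2 - a i ^ 2) ^ s * growthConst n s C L := by
  set d := b i ^ 2 - a i ^ 2 with hd
  have hd0 : 0 ≤ d := by nlinarith
  set m := ∑ j, |a j| with hm
  have hm0 : 0 ≤ m := Finset.sum_nonneg fun _ _ => abs_nonneg _
  have ham : ∀ j, |a j| ≤ m := fun j =>
    Finset.single_le_sum (f := fun j => |a j|) (fun _ _ => abs_nonneg _) (Finset.mem_univ j)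
  set G : E n → ℝ := fun w => growth C L (m * ‖w‖) / ‖w‖ ^ ((n : ℝ) + 2 * s) with hG
  set D : E n → ℝ := fun w => growth C L (√d * ‖w‖) / ‖w‖ ^ ((n : ℝ) + 2 * s) with hD
  have hGint : Integrable G := integrable_growth_mul hn hs₀ hs₁ hC L.2 hm0
  have hDint : Integrable D := integrable_growth_mul hn hs₀ hs₁ hC L.2 (Real.sqrt_nonneg d)
  have hflip : MeasurePreserving (coordFlip i) (volume : Measure (E n)) volume :=
    (coordFlip i).measurePreserving
  have hemb : MeasurableEmbedding (coordFlip i : E n → E n) :=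
    (coordFlip i).toHomeomorph.measurableEmbedding
  have hbflip : Integrable fun w => stretchIntegrand s v b (coordFlip i w) :=
    (hflip.integrable_comp_emb hemb).2 hb
  have hpt : ∀ w, stretchIntegrand s v b w + stretchIntegrand s v b (coordFlip i w) ≤
      stretchIntegrand s v a w + stretchIntegrand s v a (coordFlip i w) + D w := by
    intro w
    have h := secondDiff_stretch_add_coordFlip_le hC hv hsc hj ha hab w
    have hp : 0 ≤ (‖w‖ ^ ((n : ℝ) + 2 * s))⁻¹ := by positivity
    have := mul_le_mul_of_nonneg_right h hp
    simp only [stretchIntegrand, LinearIsometryEquiv.norm_map, hD, div_eq_mul_inv]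
    linarith
  have haG : ∀ w, stretchIntegrand s v a w ≤ G w := 
    stretchIntegrand_le s hC L.2 (secondDiff_le_growth hv hsc 0) ham hm0
  have haG' : ∀ w, stretchIntegrand s v a (coordFlip i w) ≤ G w := by
    intro w
    have := haG (coordFlip i w)
    simpa only [hG, LinearIsometryEquiv.norm_map] using this
  have hint : Integrable (stretchIntegrand s v a) := by
    -- The lower bound is the symmetrized comparison, solved for the value at `w`.
    have hbd := (((hb.add hbflip).sub hDint).norm.add hGint.norm)
    refine hbd.mono'
      (measurable_stretchIntegrand s hv.continuous.measurable a).aestronglyMeasurable ?_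
    refine Filter.Eventually.of_forall fun w => ?_
    have h1 := neg_abs_le (stretchIntegrand s v b w + stretchIntegrand s v b (coordFlip i w) - D w)
    have h2 := le_abs_self (G w)
    have h3 := abs_nonneg (stretchIntegrand s v b w + stretchIntegrand s v b (coordFlip i w) - D w)
    have h4 := hpt w
    have h5 := haG w
    have h6 := haG' w
    simp only [Pi.add_apply, Pi.sub_apply, Real.norm_eq_abs]
    exact abs_le.2 ⟨by linarith, by linarith⟩
  refine ⟨hint, ?_⟩
  have haflip : Integrable fun w => stretchIntegrand s v a (coordFlip i w) :=
    (hflip.integrable_comp_emb hemb).2 hint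
  have h := integral_mono (hb.add hbflip) ((hint.add haflip).add hDint) hpt
  rw [integral_add' hb hbflip, integral_add' (hint.add haflip) hDint, integral_add' hint haflip,
    hflip.integral_comp hemb, hflip.integral_comp hemb,
    integral_growth_mul hs₀ (Real.sqrt_nonneg d), Real.sqrt_eq_rpow, ← Real.rpow_mul hd0] at h
  have h0 : 0 ≤ d ^ s * growthConst n s C L :=
    mul_nonneg (by positivity) (growthConst_nonneg hC L.2)
  have e : 1 / 2 * (2 * s) = s := by ring
  rw [e] at h
  linarith

/-- Comparison of two operators with the same eigenvectors and with eigenvalues `aᵢ² ≤ bᵢ²`.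
Integrability for the larger one implies integrability for the smaller one. -/
theorem integral_stretchIntegrand_le {n : ℕ} (hn : 0 < n) {s : ℝ} (hs₀ : 1 / 2 < s)
    (hs₁ : s < 1) {v : E n → ℝ} {L : ℝ≥0} {C : ℝ} (hC : 0 ≤ C)
    (hv : LipschitzWith L v) (hsc : ∀ x y, secondDiff v x y ≤ C * ‖y‖ ^ 2)
    {a b : Fin n → ℝ} (ha : ∀ i, 0 ≤ a i) (hab : ∀ i, a i ≤ b i)
    (hb : Integrable (stretchIntegrand s v b)) :
    Integrable (stretchIntegrand s v a) ∧
      ∫ w, stretchIntegrand s v b w ≤ (∫ w, stretchIntegrand s v a w) +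
        (∑ i, (b i ^ 2 - a i ^ 2) ^ s) * growthConst n s C L := by
  have key : ∀ T : Finset (Fin n), Integrable (stretchIntegrand s v (T.piecewise a b)) ∧
      ∫ w, stretchIntegrand s v b w ≤ (∫ w, stretchIntegrand s v (T.piecewise a b) w) +
        (∑ i ∈ T, (b i ^ 2 - a i ^ 2) ^ s) * growthConst n s C L := by
    intro T
    induction T using Finset.induction_on with
    | empty => simp [hb]
    | insert i T hi ih =>
      have h := integral_stretchIntegrand_coord_le hn hs₀ hs₁ hC hv hsc
        (a := (insert i T).piecewise a b) (b := T.piecewise a b) (i := i)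
        (fun j hj => by simp [Finset.piecewise, hj]) (by simp [ha]) (by simp [hi, hab]) ih.1
      refine ⟨h.1, ih.2.trans ?_⟩
      have h2 := h.2
      rw [Finset.piecewise_eq_of_notMem _ _ _ hi,
        Finset.piecewise_eq_of_mem _ _ _ (Finset.mem_insert_self i T)] at h2
      rw [Finset.sum_insert hi]
      linarith
  simpa using key Finset.univ

theorem stretch_smul {n : ℕ} (r : ℝ) (a : Fin n → ℝ) (w : E n) :
    stretch (fun i => r * a i) w = stretch a (r • w) := by
  ext i; simp [stretch]; ring

theorem stretchIntegrand_def {n : ℕ} (s : ℝ) (v : E n → ℝ) (a : Fin n → ℝ) :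
    stretchIntegrand s v a =
      fun w => 1 / 2 * (secondDiff v 0 (stretch a w) / ‖w‖ ^ ((n : ℝ) + 2 * s)) := rfl

theorem integrable_stretchIntegrand_mul {n : ℕ} {s : ℝ} {v : E n → ℝ} {a : Fin n → ℝ} {r : ℝ}
    (hr : 0 < r) (ha : Integrable (stretchIntegrand s v a)) :
    Integrable (stretchIntegrand s v fun i => r * a i) := by
  have h := integrable_comp_smul_div (p := (n : ℝ) + 2 * s)
    (φ := fun w => 1 / 2 * secondDiff v 0 (stretch a w)) hr
    (by simpa only [stretchIntegrand_def, mul_div_assoc] using ha)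
  simpa only [← stretch_smul, mul_div_assoc, ← stretchIntegrand_def] using h

/-- The operator is homogeneous of degree `s` in its coefficient matrix. -/
theorem integral_stretchIntegrand_mul {n : ℕ} {s : ℝ} {v : E n → ℝ} {a : Fin n → ℝ} {r : ℝ}
    (hr : 0 < r) : ∫ w, stretchIntegrand s v (fun i => r * a i) w =
      r ^ (2 * s) * ∫ w, stretchIntegrand s v a w := by
  have h := integral_comp_smul_div (t := 2 * s)
    (fun w : E n => 1 / 2 * secondDiff v 0 (stretch a w)) hr
  simpa only [← stretch_smul, mul_div_assoc, ← stretchIntegrand_def] using h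

/-! ### The extended integral -/

theorem extIntegral_eq_integral {n : ℕ} {g : E n → ℝ} (hg : Integrable g) :
    extIntegral g = ((∫ y, g y : ℝ) : EReal) := by
  have h1 : ∫⁻ y, ENNReal.ofReal (g y) ≠ ⊤ := hg.lintegral_lt_top.ne
  have h2 : ∫⁻ y, ENNReal.ofReal (-g y) ≠ ⊤ := hg.neg.lintegral_lt_top.ne
  rw [integral_eq_lintegral_pos_part_sub_lintegral_neg_part hg, extIntegral, EReal.coe_sub,
    EReal.coe_ennreal_toReal h1, EReal.coe_ennreal_toReal h2]

theorem extIntegral_le {n : ℕ} {g G : E n → ℝ} (hG : Integrable G) (hG0 : ∀ y, 0 ≤ G y)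
    (hgG : ∀ y, g y ≤ G y) : extIntegral g ≤ ((∫ y, G y : ℝ) : EReal) := by
  have h1 : extIntegral g ≤ ((∫⁻ y, ENNReal.ofReal (g y) : ℝ≥0∞) : EReal) := by
    unfold extIntegral
    rw [sub_eq_add_neg]
    exact add_le_of_nonpos_right (EReal.neg_le_zero.2 (EReal.coe_ennreal_nonneg _))
  refine h1.trans ?_
  have h2 : ((∫ y, G y : ℝ) : EReal) = (ENNReal.ofReal (∫ y, G y) : EReal) := by
    rw [EReal.coe_ennreal_ofReal, max_eq_left (integral_nonneg hG0)]
  rw [h2, ofReal_integral_eq_lintegral_ofReal hG (Filter.Eventually.of_forall hG0)]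
  exact EReal.coe_ennreal_le_coe_ennreal_iff.2
    (lintegral_mono fun y => ENNReal.ofReal_le_ofReal (hgG y))

/-- An integrand bounded above by an integrable function has a Lebesgue integral if its extended
integral is bounded below by a real number. -/
theorem integrable_of_le_extIntegral {n : ℕ} {g G : E n → ℝ} (hg : Measurable g)
    (hG : Integrable G) (hgG : ∀ y, g y ≤ G y) {η : ℝ} (h : (η : EReal) ≤ extIntegral g) :
    Integrable g ∧ η ≤ ∫ y, g y := by
  have hint : Integrable g := by
    have hneg : ∫⁻ y, ENNReal.ofReal (-g y) < ⊤ := by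
      by_contra! htop
      rw [top_le_iff] at htop
      rw [extIntegral, htop, EReal.coe_ennreal_top, EReal.sub_top] at h
      exact absurd h (by simp)
    refine ⟨hg.aestronglyMeasurable, ?_⟩
    have hpos : ∫⁻ y, ENNReal.ofReal (g y) < ⊤ :=
      (lintegral_mono fun y => ENNReal.ofReal_le_ofReal (hgG y)).trans_lt hG.lintegral_lt_top
    have hsum : ∫⁻ y, (ENNReal.ofReal (g y) + ENNReal.ofReal (-g y)) < ⊤ := by
      rw [lintegral_add_left hg.ennreal_ofReal]
      exact ENNReal.add_lt_top.2 ⟨hpos, hneg⟩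
    refine (lintegral_mono fun y => ?_).trans_lt hsum
    rw [Real.enorm_eq_ofReal_abs]
    rcases le_total 0 (g y) with h0 | h0
    · rw [abs_of_nonneg h0]; exact le_self_add
    · rw [abs_of_nonpos h0]; exact le_add_self
  refine ⟨hint, ?_⟩
  rw [extIntegral_eq_integral hint] at h
  exact_mod_cast h

/-- A reverse Fatou lemma for the extended integral: lower bounds pass to pointwise limits under an
integrable upper bound, and the limit is integrable. -/
theorem integrable_of_tendsto_of_le_extIntegral {n : ℕ} {g : E n → ℝ} {gs : ℕ → E n → ℝ}
    {G : E n → ℝ} (hg : Measurable g) (hgs : ∀ k, Measurable (gs k)) (hGm : Measurable G)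
    (hG : Integrable G) (hgG : ∀ k y, gs k y ≤ G y)
    (hlim : ∀ᵐ y, Filter.Tendsto (fun k => gs k y) Filter.atTop (nhds (g y)))
    {η : ℝ} (h : ∀ k, (η : EReal) ≤ extIntegral (gs k)) :
    Integrable g ∧ η ≤ ∫ y, g y := by
  have hk : ∀ k, Integrable (gs k) ∧ η ≤ ∫ y, gs k y := fun k =>
    integrable_of_le_extIntegral (hgs k) hG (hgG k) (h k)
  have hle : ∀ k, ∫⁻ y, ENNReal.ofReal (G y - gs k y) ≤ ENNReal.ofReal ((∫ y, G y) - η) := by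
    intro k
    have hsub : Integrable fun y => G y - gs k y := hG.sub (hk k).1
    rw [← ofReal_integral_eq_lintegral_ofReal hsub
      (Filter.Eventually.of_forall fun y => sub_nonneg.2 (hgG k y)), integral_sub hG (hk k).1]
    exact ENNReal.ofReal_le_ofReal (by linarith [(hk k).2])
  have hge : ∀ᵐ y, g y ≤ G y := hlim.mono fun y hy => le_of_tendsto' hy fun k => hgG k y
  have hfatou : ∫⁻ y, ENNReal.ofReal (G y - g y) ≤ ENNReal.ofReal ((∫ y, G y) - η) := by
    have h1 : ∫⁻ y, ENNReal.ofReal (G y - g y) =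
        ∫⁻ y, Filter.liminf (fun k => ENNReal.ofReal (G y - gs k y)) Filter.atTop := by
      refine lintegral_congr_ae (hlim.mono fun y hy => ?_)
      exact ((ENNReal.continuous_ofReal.tendsto _).comp (hy.const_sub (G y))).liminf_eq.symm
    rw [h1]
    refine (lintegral_liminf_le fun k => (hGm.sub (hgs k)).ennreal_ofReal).trans ?_
    exact Filter.liminf_le_of_le (by isBoundedDefault) fun b hb => by
      obtain ⟨k, hk'⟩ := hb.exists
      exact hk'.trans (hle k)
  have hnn : 0 ≤ᵐ[volume] fun y => G y - g y := hge.mono fun y hy => sub_nonneg.2 hy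
  have hsub : Integrable fun y => G y - g y :=
    ⟨(hGm.sub hg).aestronglyMeasurable,
      (hasFiniteIntegral_iff_ofReal hnn).2 (hfatou.trans_lt ENNReal.ofReal_lt_top)⟩
  have hint : Integrable g :=
    (hG.sub hsub).congr (Filter.Eventually.of_forall fun y => sub_sub_cancel (G y) (g y))
  refine ⟨hint, ?_⟩
  rw [← ofReal_integral_eq_lintegral_ofReal hsub hnn] at hfatou
  have hη : 0 ≤ (∫ y, G y) - η := by
    have h0 := hk 0
    have h1 := integral_mono h0.1 hG (hgG 0)
    linarith [h0.2]
  have := (ENNReal.ofReal_le_ofReal_iff hη).1 hfatou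
  rw [integral_sub hG hint] at this
  linarith

/-! ### The function `σ₂^{1/2}` and its linearized coefficients -/

theorem two_mul_sum_powersetCard_two {ι : Type*} [DecidableEq ι] (t : Finset ι) (l : ι → ℝ) :
    2 * ∑ r ∈ t.powersetCard 2, ∏ i ∈ r, l i = (∑ i ∈ t, l i) ^ 2 - ∑ i ∈ t, l i ^ 2 := by
  induction t using Finset.induction_on with
  | empty => rw [Finset.powersetCard_eq_empty.2 (by simp)]; simp
  | insert i t hi ih =>
    have hdisj : Disjoint (t.powersetCard 2) ((t.powersetCard 1).image (insert i)) := by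
      rw [Finset.disjoint_left]
      intro r hr hr'
      obtain ⟨q, -, rfl⟩ := Finset.mem_image.1 hr'
      exact hi ((Finset.mem_powersetCard.1 hr).1 (Finset.mem_insert_self i q))
    rw [Finset.powersetCard_succ_insert hi, Finset.sum_union hdisj, Finset.powersetCard_one,
      Finset.sum_image, Finset.sum_map, Finset.sum_insert hi, Finset.sum_insert hi, mul_add, ih]
    · have : ∀ j ∈ t, ∏ k ∈ insert i {j}, l k = l i * l j := by
        intro j hj
        rw [Finset.prod_insert (by simpa using fun h : i = j => hi (h ▸ hj)),
          Finset.prod_singleton]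
      simp only [Function.Embedding.coeFn_mk]
      rw [Finset.sum_congr rfl this, ← Finset.mul_sum]
      ring
    · intro r hr q hq hrq
      simp only [Finset.coe_map, Set.mem_image, Finset.mem_coe, Function.Embedding.coeFn_mk]
        at hr hq
      obtain ⟨j, hj, rfl⟩ := hr
      obtain ⟨k, hk, rfl⟩ := hq
      have h1 : j ∈ insert i ({k} : Finset ι) := hrq ▸ by simp
      have h2 : j ≠ i := fun h => hi (h ▸ hj)
      simpa [h2] using h1

theorem sigma_one {n : ℕ} (l : Fin n → ℝ) : sigma 1 l = ∑ i, l i := by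
  simp [sigma, Finset.powersetCard_one]

theorem sigma_two {n : ℕ} (l : Fin n → ℝ) :
    sigma 2 l = ((∑ i, l i) ^ 2 - ∑ i, l i ^ 2) / 2 := by
  have := two_mul_sum_powersetCard_two Finset.univ l
  unfold sigma
  linarith

/-- The symmetric matrix `U diag(m) Uᵀ` with eigenvectors the columns of the orthogonal matrix `U`
and eigenvalues `m`. -/
def conjDiag {n : ℕ} (U : Matrix.unitaryGroup (Fin n) ℝ) (m : Fin n → ℝ) :
    Matrix (Fin n) (Fin n) ℝ :=
  (U : Matrix (Fin n) (Fin n) ℝ) * Matrix.diagonal m * star (U : Matrix (Fin n) (Fin n) ℝ)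

theorem conjDiag_mul {n : ℕ} (U : Matrix.unitaryGroup (Fin n) ℝ) (m m' : Fin n → ℝ) :
    conjDiag U m * conjDiag U m' = conjDiag U fun i => m i * m' i := by
  unfold conjDiag
  rw [← Matrix.diagonal_mul_diagonal]
  calc _ = (U : Matrix (Fin n) (Fin n) ℝ) * Matrix.diagonal m *
        (star (U : Matrix (Fin n) (Fin n) ℝ) * (U : Matrix (Fin n) (Fin n) ℝ)) *
        Matrix.diagonal m' * star (U : Matrix (Fin n) (Fin n) ℝ) := by
        simp only [Matrix.mul_assoc]
    _ = _ := by rw [Unitary.coe_star_mul_self]; simp only [Matrix.mul_assoc, Matrix.one_mul]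

theorem trace_conjDiag {n : ℕ} (U : Matrix.unitaryGroup (Fin n) ℝ) (m : Fin n → ℝ) :
    (conjDiag U m).trace = ∑ i, m i := by
  unfold conjDiag
  rw [Matrix.trace_mul_comm, ← Matrix.mul_assoc, Unitary.coe_star_mul_self, Matrix.one_mul,
    Matrix.trace_diagonal]

theorem conjDiag_one {n : ℕ} (U : Matrix.unitaryGroup (Fin n) ℝ) :
    conjDiag U (fun _ => 1) = 1 := by
  simp [conjDiag]

theorem det_conjDiag {n : ℕ} (U : Matrix.unitaryGroup (Fin n) ℝ) (m : Fin n → ℝ) :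
    (conjDiag U m).det = ∏ i, m i := by
  unfold conjDiag
  rw [Matrix.det_mul_comm, ← Matrix.mul_assoc, Unitary.coe_star_mul_self, Matrix.one_mul,
    Matrix.det_diagonal]

theorem posDef_conjDiag {n : ℕ} (U : Matrix.unitaryGroup (Fin n) ℝ) {m : Fin n → ℝ}
    (hm : ∀ i, 0 < m i) : (conjDiag U m).PosDef := by
  have h := (Matrix.PosDef.diagonal hm).mul_mul_conjTranspose_same
    (B := (U : Matrix (Fin n) (Fin n) ℝ)) (by
      refine Matrix.vecMul_injective_of_isUnit ?_
      exact (Unitary.toUnits U).isUnit)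
  exact h

theorem eq_conjDiag {n : ℕ} {A : Matrix (Fin n) (Fin n) ℝ} (hA : A.IsHermitian) :
    A = conjDiag hA.eigenvectorUnitary hA.eigenvalues := by
  conv_lhs => rw [hA.spectral_theorem]
  rfl

theorem sum_eigenvals {n : ℕ} {A : Matrix (Fin n) (Fin n) ℝ} (hA : A.IsHermitian) :
    ∑ i, eigenvals A i = A.trace := by
  conv_rhs => rw [eq_conjDiag hA]
  rw [trace_conjDiag, eigenvals, dif_pos hA]

theorem sum_eigenvals_sq {n : ℕ} {A : Matrix (Fin n) (Fin n) ℝ} (hA : A.IsHermitian) :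
    ∑ i, eigenvals A i ^ 2 = (A * A).trace := by
  conv_rhs => rw [eq_conjDiag hA]
  rw [conjDiag_mul, trace_conjDiag, eigenvals, dif_pos hA]
  simp only [sq]

/-- The second elementary symmetric function of the eigenvalues of `A`, as a polynomial in the
entries of `A`. -/
def traceSigmaTwo {n : ℕ} (A : Matrix (Fin n) (Fin n) ℝ) : ℝ := (A.trace ^ 2 - (A * A).trace) / 2

theorem sigma_two_eigenvals {n : ℕ} {A : Matrix (Fin n) (Fin n) ℝ} (hA : A.IsHermitian) :
    sigma 2 (eigenvals A) = traceSigmaTwo A := by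
  rw [sigma_two, sum_eigenvals hA, sum_eigenvals_sq hA, traceSigmaTwo]

theorem eigenvals_mem_GammaCone_two {n : ℕ} {A : Matrix (Fin n) (Fin n) ℝ} (hA : A.IsHermitian) :
    eigenvals A ∈ GammaCone n 2 ↔ 0 < A.trace ∧ 0 < traceSigmaTwo A := by
  constructor
  · intro h
    have h1 := h 1 le_rfl one_le_two
    have h2 := h 2 one_le_two le_rfl
    rw [sigma_one, sum_eigenvals hA] at h1
    rw [sigma_two_eigenvals hA] at h2
    exact ⟨h1, h2⟩
  · rintro ⟨h1, h2⟩ j hj1 hj2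
    interval_cases j
    · rwa [sigma_one, sum_eigenvals hA]
    · rwa [sigma_two_eigenvals hA]

theorem isHermitian_of_isSymm {n : ℕ} {A : Matrix (Fin n) (Fin n) ℝ} (hA : A.IsSymm) :
    A.IsHermitian := by
  rw [Matrix.IsHermitian, Matrix.conjTranspose_eq_transpose_of_trivial]; exact hA

/-- The gradient of `σ₂^{1/2}` at `T` is `((tr T) I - T) / (2 σ₂(T)^{1/2})`. -/
theorem hasDerivAt_spectralFun {n : ℕ} {T H : Matrix (Fin n) (Fin n) ℝ} (hT : T.IsSymm)
    (hH : H.IsSymm) (hpos : 0 < traceSigmaTwo T) :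
    HasDerivAt (fun t : ℝ => spectralFun (sigmaRoot n 2) (T + t • H))
      ((((2 * √(traceSigmaTwo T))⁻¹ • (T.trace • (1 : Matrix (Fin n) (Fin n) ℝ) - T)) * H).trace)
      0 := by
  have hfun : (fun t : ℝ => spectralFun (sigmaRoot n 2) (T + t • H)) = fun t : ℝ =>
      √(traceSigmaTwo T + t * (T.trace * H.trace - (T * H).trace) + t ^ 2 * traceSigmaTwo H) := by
    funext t
    have hsymm : (T + t • H).IsSymm := hT.add (hH.smul t)
    rw [spectralFun, sigmaRoot, sigma_two_eigenvals (isHermitian_of_isSymm hsymm),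
      Real.sqrt_eq_rpow]
    push_cast
    congr 1
    simp only [traceSigmaTwo, Matrix.add_mul, Matrix.mul_add, Matrix.trace_add, Matrix.smul_mul,
      Matrix.mul_smul, Matrix.trace_smul, smul_eq_mul, Matrix.trace_mul_comm H T]
    ring
  rw [hfun]
  set D := T.trace * H.trace - (T * H).trace with hD
  have h1 : HasDerivAt (fun t : ℝ => traceSigmaTwo T + t * D + t ^ 2 * traceSigmaTwo H) D 0 := by
    have := (((hasDerivAt_id' (0 : ℝ)).mul_const D).const_add (traceSigmaTwo T)).fun_add
      (((hasDerivAt_id' (0 : ℝ)).fun_pow 2).mul_const (traceSigmaTwo H))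
    exact this.congr_deriv (by simp)
  have h2 := h1.sqrt (by simpa using hpos.ne')
  convert h2 using 1
  simp only [Matrix.smul_mul, Matrix.trace_smul, Matrix.sub_mul, Matrix.trace_sub, Matrix.one_mul,
    smul_eq_mul, ← hD]
  simp
  ring

/-- The set `𝓜` of linearized coefficients is the positive definite part of a quadric. The preimage
of `M` used in the converse is `T = (tr M / (n - 1)) I - M`, normalized by `σ₂(T) = 1/4`. -/
theorem mem_coeffSet_iff {n : ℕ} (hn : 2 ≤ n) {M : Matrix (Fin n) (Fin n) ℝ} :
    M ∈ coeffSet (sigmaRoot n 2) (GammaCone n 2) ↔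
      M.PosDef ∧ M.trace ^ 2 / ((n : ℝ) - 1) - (M * M).trace = 1 / 2 := by
  have hn' : (0 : ℝ) < (n : ℝ) - 1 := by
    have : (2 : ℝ) ≤ n := by exact_mod_cast hn
    linarith
  constructor
  · rintro ⟨hM, T, hT, hΓ, hMs, hgrad⟩
    refine ⟨hM, ?_⟩
    rw [eigenvals_mem_GammaCone_two (isHermitian_of_isSymm hT)] at hΓ
    set r := (2 * √(traceSigmaTwo T))⁻¹ with hr
    have hr2 : r ^ 2 * traceSigmaTwo T = 1 / 4 := by
      rw [hr, inv_pow, mul_pow, Real.sq_sqrt hΓ.2.le]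
      have := hΓ.2.ne'
      field_simp
      norm_num
    set M' := r • (T.trace • (1 : Matrix (Fin n) (Fin n) ℝ) - T) with hM'
    have hM's : M'.IsSymm := ((Matrix.isSymm_one.smul _).sub hT).smul _
    -- The gradient is unique: test it against the direction `M - M'`.
    have hMM' : M = M' := by
      have hs : (M - M').IsSymm := hMs.sub hM's
      have h := (hgrad _ hs).unique (hasDerivAt_spectralFun hT hs hΓ.2)
      have h0 : ((M - M').conjTranspose * (M - M')).trace = 0 := by
        rw [Matrix.conjTranspose_eq_transpose_of_trivial, hs, Matrix.sub_mul, Matrix.trace_sub, h,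
          sub_self]
      exact sub_eq_zero.1 (Matrix.trace_conjTranspose_mul_self_eq_zero_iff.1 h0)
    have htr : M.trace = r * (((n : ℝ) - 1) * T.trace) := by
      rw [hMM', hM']
      simp only [Matrix.trace_smul, Matrix.trace_sub, Matrix.trace_one, Fintype.card_fin,
        smul_eq_mul]
      ring
    have htr2 : (M * M).trace = r ^ 2 * (((n : ℝ) - 2) * T.trace ^ 2 + (T * T).trace) := by
      rw [hMM', hM']
      simp [Matrix.sub_mul, Matrix.mul_sub]
      ring
    rw [htr, htr2]
    unfold traceSigmaTwo at hr2
    field_simp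
    linear_combination 4 * hr2
  · rintro ⟨hM, hq⟩
    have hMs : M.IsSymm := by
      have := hM.isHermitian
      rwa [Matrix.IsHermitian, Matrix.conjTranspose_eq_transpose_of_trivial] at this
    have : Nonempty (Fin n) := ⟨⟨0, by omega⟩⟩
    have htr : 0 < M.trace := hM.trace_pos
    set T := (M.trace / ((n : ℝ) - 1)) • (1 : Matrix (Fin n) (Fin n) ℝ) - M with hT
    have hTs : T.IsSymm := (Matrix.isSymm_one.smul _).sub hMs
    have hTtr : T.trace = M.trace / ((n : ℝ) - 1) := by
      rw [hT]
      simp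
      field_simp
      ring
    have hTT : traceSigmaTwo T = 1 / 4 := by
      have : (T * T).trace = n * (M.trace / ((n : ℝ) - 1)) ^ 2
          - 2 * (M.trace / ((n : ℝ) - 1)) * M.trace + (M * M).trace := by
        rw [hT]
        simp [Matrix.sub_mul, Matrix.mul_sub]
        ring
      rw [traceSigmaTwo, this, hTtr]
      set k := M.trace / ((n : ℝ) - 1) with hk
      have hτ : M.trace = k * ((n : ℝ) - 1) := by rw [hk]; field_simp
      have hq' : k * M.trace - (M * M).trace = 1 / 2 := by rw [← hq, hk]; ring
      linear_combination hq' / 2 + k / 2 * hτ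
    refine ⟨hM, T, hTs, (eigenvals_mem_GammaCone_two (isHermitian_of_isSymm hTs)).2
      ⟨by rw [hTtr]; positivity, by rw [hTT]; norm_num⟩, hMs, fun H hH => ?_⟩
    have h := hasDerivAt_spectralFun hTs hH (by rw [hTT]; norm_num)
    have hs : √(1 / 4 : ℝ) = 1 / 2 := by
      rw [show (1 / 4 : ℝ) = (1 / 2) ^ 2 by norm_num, Real.sqrt_sq (by norm_num)]
    have hMT : (2 * √(traceSigmaTwo T))⁻¹ • (T.trace • (1 : Matrix (Fin n) (Fin n) ℝ) - T) = M := by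
      rw [hTT, hs, hTtr, hT]
      norm_num
    rwa [hMT] at h

theorem conjDiag_mem_coeffSet {n : ℕ} (hn : 2 ≤ n) (U : Matrix.unitaryGroup (Fin n) ℝ)
    {m : Fin n → ℝ} (hm : ∀ i, 0 < m i)
    (hq : (∑ i, m i) ^ 2 / ((n : ℝ) - 1) - ∑ i, m i ^ 2 = 1 / 2) :
    conjDiag U m ∈ coeffSet (sigmaRoot n 2) (GammaCone n 2) := by
  refine (mem_coeffSet_iff hn).2 ⟨posDef_conjDiag U hm, ?_⟩
  rw [conjDiag_mul, trace_conjDiag, trace_conjDiag]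
  simpa only [← sq] using hq

theorem exists_conjDiag_of_mem_coeffSet {n : ℕ} (hn : 2 ≤ n) {M : Matrix (Fin n) (Fin n) ℝ}
    (hM : M ∈ coeffSet (sigmaRoot n 2) (GammaCone n 2)) :
    ∃ U : Matrix.unitaryGroup (Fin n) ℝ, M = conjDiag U (eigenvals M) ∧
      (∀ i, 0 < eigenvals M i) ∧
      (∑ i, eigenvals M i) ^ 2 / ((n : ℝ) - 1) - ∑ i, eigenvals M i ^ 2 = 1 / 2 := by
  obtain ⟨hpos, hq⟩ := (mem_coeffSet_iff hn).1 hM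
  have hH := hpos.isHermitian
  refine ⟨hH.eigenvectorUnitary, ?_, fun i => ?_, ?_⟩
  · rw [eigenvals, dif_pos hH]; exact eq_conjDiag hH
  · rw [eigenvals, dif_pos hH]; exact hpos.eigenvalues_pos i
  · rwa [sum_eigenvals hH, sum_eigenvals_sq hH]

theorem lambdaMin_conjDiag_const {n : ℕ} (hn : 0 < n) (U : Matrix.unitaryGroup (Fin n) ℝ)
    {a : ℝ} (ha : 0 < a) : lambdaMin (conjDiag U fun _ => a) = a := by
  have : Nonempty (Fin n) := ⟨⟨0, hn⟩⟩
  have hH := (posDef_conjDiag U (m := fun _ => a) fun _ => ha).isHermitian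
  have hsc : conjDiag U (fun _ => a) = algebraMap ℝ (Matrix (Fin n) (Fin n) ℝ) a := by
    rw [Algebra.algebraMap_eq_smul_one, ← conjDiag_one U, conjDiag, conjDiag, ← Matrix.smul_mul,
      ← Matrix.mul_smul, ← Matrix.diagonal_smul]
    congr 3
    ext; simp
  have h : ∀ i, eigenvals (conjDiag U fun _ => a) i = a := by
    intro i
    rw [eigenvals, dif_pos hH]
    have h1 : spectrum ℝ (conjDiag U fun _ => a) = {a} := by
      rw [hsc, spectrum.scalar_eq]
    simpa only [h1, Set.mem_singleton_iff] using hH.eigenvalues_mem_spectrum_real i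
  simp [lambdaMin, h]

/-! ### Diagonalization of the linear operators -/

theorem sqrt_conjDiag {n : ℕ} (U : Matrix.unitaryGroup (Fin n) ℝ) {m : Fin n → ℝ}
    (hm : ∀ i, 0 < m i) : CFC.sqrt (conjDiag U m) = conjDiag U fun i => √(m i) := by
  refine CFC.sqrt_unique ?_ ?_
  · rw [conjDiag_mul]
    simp only [Real.mul_self_sqrt (hm _).le]
  · exact Matrix.nonneg_iff_posSemidef.2
      (posDef_conjDiag U fun i => Real.sqrt_pos.2 (hm i)).posSemidef

theorem inv_conjDiag {n : ℕ} (U : Matrix.unitaryGroup (Fin n) ℝ) {m : Fin n → ℝ}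
    (hm : ∀ i, m i ≠ 0) : (conjDiag U m)⁻¹ = conjDiag U fun i => (m i)⁻¹ := by
  refine Matrix.inv_eq_right_inv ?_
  rw [conjDiag_mul]
  simp only [mul_inv_cancel₀ (hm _), conjDiag_one]

theorem extIntegral_comp_linearMap {n : ℕ} (g : E n → ℝ) {f : E n →ₗ[ℝ] E n}
    (hf : LinearMap.det f ≠ 0) :
    extIntegral g = extIntegral fun w => |LinearMap.det f| * g (f w) := by
  have hemb : MeasurableEmbedding f :=
    (f.equivOfDetNeZero hf).toContinuousLinearEquiv.toHomeomorph.measurableEmbedding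
  have key : ∀ h : E n → ℝ, ∫⁻ y, ENNReal.ofReal (h y) =
      ∫⁻ w, ENNReal.ofReal (|LinearMap.det f| * h (f w)) := by
    intro h
    simp only [ENNReal.ofReal_mul (abs_nonneg _)]
    rw [lintegral_const_mul' _ _ ENNReal.ofReal_ne_top,
      ← hemb.lintegral_map (fun y => ENNReal.ofReal (h y)),
      Measure.map_linearMap_addHaar_eq_smul_addHaar volume hf, lintegral_smul_measure, smul_eq_mul,
      ← mul_assoc, ← ENNReal.ofReal_mul (abs_nonneg _), ← abs_mul, mul_inv_cancel₀ hf]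
    simp
  unfold extIntegral
  rw [key g, key fun y => -g y]
  simp only [mul_neg]

theorem norm_toEuclideanLin_unitary {n : ℕ} (U : Matrix.unitaryGroup (Fin n) ℝ) (w : E n) :
    ‖Matrix.toEuclideanLin (U : Matrix (Fin n) (Fin n) ℝ) w‖ = ‖w‖ := by
  have h : inner ℝ (Matrix.toEuclideanLin (U : Matrix (Fin n) (Fin n) ℝ) w)
      (Matrix.toEuclideanLin (U : Matrix (Fin n) (Fin n) ℝ) w) = inner ℝ w w := by
    rw [← LinearMap.adjoint_inner_left, ← Matrix.toEuclideanLin_conjTranspose_eq_adjoint,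
      ← LinearMap.comp_apply, ← Matrix.toLpLin_mul_same, ← Matrix.star_eq_conjTranspose,
      Unitary.coe_star_mul_self, Matrix.toLpLin_one, LinearMap.id_apply]
  rw [real_inner_self_eq_norm_sq, real_inner_self_eq_norm_sq] at h
  exact (sq_eq_sq₀ (norm_nonneg _) (norm_nonneg _)).1 h

theorem toEuclideanLin_diagonal {n : ℕ} (a : Fin n → ℝ) (w : E n) :
    Matrix.toEuclideanLin (Matrix.diagonal a) w = stretch a w := by
  ext i
  simp [stretch, Matrix.mulVec_diagonal]

/-- The linear operator in diagonalized coordinates, by the substitution `y = U diag(√m) w`. -/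
theorem linearOp_conjDiag {n : ℕ} (s : ℝ) (U : Matrix.unitaryGroup (Fin n) ℝ) {m : Fin n → ℝ}
    (hm : ∀ i, 0 < m i) (v : E n → ℝ) (x : E n) :
    linearOp s (conjDiag U m) v x = extIntegral (stretchIntegrand s
      (fun w => v (x + Matrix.toEuclideanLin (U : Matrix (Fin n) (Fin n) ℝ) w))
      fun i => √(m i)) := by
  have hr : ∀ i, 0 < √(m i) := fun i => Real.sqrt_pos.2 (hm i)
  set P : Matrix (Fin n) (Fin n) ℝ := U * Matrix.diagonal fun i => √(m i) with hP
  have hdetU : |(U : Matrix (Fin n) (Fin n) ℝ).det| = 1 := by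
    have h := congrArg Matrix.det (Unitary.coe_star_mul_self U)
    rw [Matrix.det_mul, Matrix.star_eq_conjTranspose, Matrix.det_conjTranspose, Matrix.det_one,
      star_trivial, ← sq] at h
    rwa [← sq_abs, pow_eq_one_iff_of_nonneg (abs_nonneg _) two_ne_zero] at h
  have hdet : |LinearMap.det (Matrix.toEuclideanLin P)| = ∏ i, √(m i) := by
    rw [LinearMap.det_toLpLin, hP, Matrix.det_mul, abs_mul, hdetU, Matrix.det_diagonal, one_mul,
      abs_of_pos (Finset.prod_pos fun i _ => hr i)]
  have hdet0 : LinearMap.det (Matrix.toEuclideanLin P) ≠ 0 := by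
    rw [← abs_pos, hdet]
    exact Finset.prod_pos fun i _ => hr i
  have hPw : ∀ w, Matrix.toEuclideanLin P w =
      Matrix.toEuclideanLin (U : Matrix (Fin n) (Fin n) ℝ) (stretch (fun i => √(m i)) w) := by
    intro w
    rw [hP, Matrix.toLpLin_mul_same, LinearMap.comp_apply, toEuclideanLin_diagonal]
  have hinv : conjDiag U (fun i => (√(m i))⁻¹) * P = U := by
    rw [hP, conjDiag, Matrix.mul_assoc, ← Matrix.mul_assoc (star _), Unitary.coe_star_mul_self,
      Matrix.one_mul, Matrix.mul_assoc, Matrix.diagonal_mul_diagonal]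
    simp [inv_mul_cancel₀ (hr _).ne']
  rw [linearOp, extIntegral_comp_linearMap _ hdet0, sqrt_conjDiag U hm,
    inv_conjDiag U fun i => (hr i).ne', det_conjDiag, hdet]
  congr 1
  funext w
  rw [← LinearMap.comp_apply (Matrix.toEuclideanLin (conjDiag U _)), ← Matrix.toLpLin_mul_same,
    hinv, norm_toEuclideanLin_unitary, hPw]
  have hprod : (∏ i, √(m i)) * ∏ i, (√(m i))⁻¹ = 1 := by
    rw [← Finset.prod_mul_distrib]
    exact Finset.prod_eq_one fun i _ => mul_inv_cancel₀ (hr i).ne'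
  simp only [stretchIntegrand, secondDiff, zero_add, zero_sub, map_zero, add_zero, map_neg,
    ← sub_eq_add_neg]
  linear_combination (1 / 2 * ((v (x + Matrix.toEuclideanLin (U : Matrix (Fin n) (Fin n) ℝ)
    (stretch (fun i => √(m i)) w)) + v (x - Matrix.toEuclideanLin (U : Matrix (Fin n) (Fin n) ℝ)
    (stretch (fun i => √(m i)) w)) - 2 * v x) / ‖w‖ ^ ((n : ℝ) + 2 * s))) * hprod

/-! ### From the viscosity inequality to pointwise bounds -/

theorem secondDiff_comp_unitary {n : ℕ} (U : Matrix.unitaryGroup (Fin n) ℝ) (v : E n → ℝ)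
    (x z y : E n) :
    secondDiff (fun w => v (x + Matrix.toEuclideanLin (U : Matrix (Fin n) (Fin n) ℝ) w)) z y =
      secondDiff v (x + Matrix.toEuclideanLin (U : Matrix (Fin n) (Fin n) ℝ) z)
        (Matrix.toEuclideanLin (U : Matrix (Fin n) (Fin n) ℝ) y) := by
  simp only [secondDiff, map_add, map_sub, add_assoc, add_sub_assoc]

theorem lipschitzWith_comp_unitary {n : ℕ} (U : Matrix.unitaryGroup (Fin n) ℝ) {u : E n → ℝ}
    {L : ℝ≥0} (hu : LipschitzWith L u) (x : E n) : LipschitzWith L fun w =>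
      u (x + Matrix.toEuclideanLin (U : Matrix (Fin n) (Fin n) ℝ) w) := by
  refine LipschitzWith.of_dist_le_mul fun y z => (hu.dist_le_mul _ _).trans_eq ?_
  rw [dist_add_left, dist_eq_norm, ← map_sub, norm_toEuclideanLin_unitary, dist_eq_norm]

/-- A semi-concave function is touched strictly from above by a paraboloid at every point. The
opening exceeds that given by semi-concavity, which makes the contact strict. -/
theorem exists_touching_paraboloid {n : ℕ} {u : E n → ℝ} (hu : Continuous u) {C : ℝ}
    (hsc : ∀ x y, secondDiff u x y ≤ C * ‖y‖ ^ 2) (x : E n) :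
    ∃ ψ : E n → ℝ, ContDiff ℝ 2 ψ ∧ ψ x = u x ∧ (∀ y, y ≠ x → u y < ψ y) ∧
      ∀ y, secondDiff ψ x y = (C + 2) * ‖y‖ ^ 2 := by
  have hpar : ∀ a b : E n, ‖a + b‖ ^ 2 + ‖a - b‖ ^ 2 = 2 * ‖a‖ ^ 2 + 2 * ‖b‖ ^ 2 := by
    intro a b
    have := parallelogram_law_with_norm ℝ a b
    linear_combination this
  have hconc : ConcaveOn ℝ Set.univ fun y : E n => u y - C / 2 * ‖y‖ ^ 2 := by
    refine concaveOn_of_midpoint (by fun_prop) fun y h => ?_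
    have h1 := hsc y h
    have h2 := hpar y h
    unfold secondDiff at h1
    linear_combination h1 - C / 2 * h2
  obtain ⟨p, hp⟩ := exists_supergradient (by fun_prop) hconc x
  refine ⟨fun y => u x + p (y - x) + C / 2 * (‖y‖ ^ 2 - ‖x‖ ^ 2) + ‖y - x‖ ^ 2, ?_, by simp,
    fun y hy => ?_, fun y => ?_⟩
  · have h1 : ContDiff ℝ 2 fun y : E n => ‖y‖ ^ 2 := contDiff_norm_sq ℝ
    have h2 : ContDiff ℝ 2 fun y : E n => ‖y - x‖ ^ 2 := h1.comp (contDiff_id.sub contDiff_const)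
    have h3 : ContDiff ℝ 2 fun y : E n => p (y - x) :=
      p.contDiff.comp (contDiff_id.sub contDiff_const)
    exact ((contDiff_const.add h3).add (contDiff_const.mul (h1.sub contDiff_const))).add h2
  · have h1 := hp y
    have h2 : 0 < ‖y - x‖ ^ 2 := by
      have := norm_pos_iff.2 (sub_ne_zero.2 hy)
      positivity
    linarith
  · have h2 := hpar x y
    simp only [secondDiff, add_sub_cancel_left, sub_sub_cancel_left, map_neg, norm_neg, sub_self,
      map_zero, norm_zero]
    linear_combination C / 2 * h2

/-- The viscosity inequality for a Lipschitz semi-concave function holds pointwise, for each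
operator of the family separately. -/
theorem integral_stretchIntegrand_ge_of_viscosity {n : ℕ} (hn : 0 < n) {s : ℝ} (hs₀ : 1 / 2 < s)
    (hs₁ : s < 1) {f : (Fin n → ℝ) → ℝ} {Γ : Set (Fin n → ℝ)} {η₀ : ℝ} {L : ℝ≥0} {C : ℝ}
    (hC : 0 ≤ C) {Ω : Set (E n)} (hΩ : IsOpen Ω) {u : E n → ℝ} (hu : LipschitzWith L u)
    (hsc : ∀ x y, secondDiff u x y ≤ C * ‖y‖ ^ 2)
    (hvisc : IsViscositySubsolution
      (fun v x => ((1 - s : ℝ) : EReal) * fracHessian f Γ s v x) (fun _ => η₀) Ω u)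
    {x : E n} (hx : x ∈ Ω) (U : Matrix.unitaryGroup (Fin n) ℝ) {m : Fin n → ℝ}
    (hm : ∀ i, 0 < m i) (hM : conjDiag U m ∈ coeffSet f Γ) :
    Integrable (stretchIntegrand s
      (fun w => u (x + Matrix.toEuclideanLin (U : Matrix (Fin n) (Fin n) ℝ) w))
      fun i => √(m i)) ∧
    η₀ / (1 - s) ≤ ∫ w, stretchIntegrand s
      (fun w => u (x + Matrix.toEuclideanLin (U : Matrix (Fin n) (Fin n) ℝ) w))
      (fun i => √(m i)) w := by
  classical
  obtain ⟨ψ, hψ, hψx, hψu, hψδ⟩ := exists_touching_paraboloid hu.continuous hsc x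
  obtain ⟨r₀, hr₀, hball⟩ := Metric.isOpen_iff.1 hΩ x hx
  set r : ℕ → ℝ := fun k => r₀ / (k + 1) with hr
  have hrpos : ∀ k, 0 < r k := fun k => by positivity
  have hrle : ∀ k, r k ≤ r₀ := fun k => div_le_self hr₀.le (by
    have : (0 : ℝ) ≤ k := Nat.cast_nonneg k
    linarith)
  have hrlim : Filter.Tendsto r Filter.atTop (nhds 0) := by
    have := (tendsto_one_div_add_atTop_nhds_zero_nat (𝕜 := ℝ)).const_mul r₀
    simpa [hr, div_eq_mul_inv] using this
  set v : ℕ → E n → ℝ := fun k y => if y ∈ Metric.ball x (r k) then ψ y else u y with hv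
  have hvx : ∀ k, v k x = u x := fun k => by
    simp only [hv, Metric.mem_ball_self (hrpos k), if_true, hψx]
  have hin : ∀ k y, ‖y‖ < r k → secondDiff (v k) x y = (C + 2) * ‖y‖ ^ 2 := by
    intro k y hy
    have h1 : x + y ∈ Metric.ball x (r k) := by simpa [dist_eq_norm] using hy
    have h2 : x - y ∈ Metric.ball x (r k) := by simpa [dist_eq_norm] using hy
    rw [← hψδ y, secondDiff, hvx, secondDiff, hψx]
    simp only [hv, h1, h2, if_true]
  have hout : ∀ k y, r k ≤ ‖y‖ → secondDiff (v k) x y = secondDiff u x y := by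
    intro k y hy
    have h1 : x + y ∉ Metric.ball x (r k) := by simpa [dist_eq_norm] using hy
    have h2 : x - y ∉ Metric.ball x (r k) := by simpa [dist_eq_norm] using hy
    rw [secondDiff, hvx, secondDiff]
    simp only [hv, h1, h2, if_false]
  -- On balls of radius at most `r₀`, the paraboloid also satisfies a linear bound.
  set L' : ℝ := L + (C + 2) * r₀ with hL'
  have hL'0 : 0 ≤ L' := by positivity
  have hbd : ∀ k y, secondDiff (v k) x y ≤ growth (C + 2) L' ‖y‖ := by
    intro k y
    have hy0 := norm_nonneg y
    rcases lt_or_ge ‖y‖ (r k) with hy | hy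
    · rw [hin k y hy]
      refine le_min le_rfl ?_
      have h1 : ‖y‖ ≤ r₀ := hy.le.trans (hrle k)
      have h2 : (C + 2) * ‖y‖ * ‖y‖ ≤ (C + 2) * r₀ * ‖y‖ := by gcongr
      have h3 : 0 ≤ (L : ℝ) * ‖y‖ := by positivity
      have h4 : 0 ≤ (C + 2) * r₀ * ‖y‖ := by positivity
      rw [hL']
      nlinarith
    · rw [hout k y hy]
      refine (secondDiff_le_growth hu hsc x y).trans (min_le_min ?_ ?_)
      · gcongr; linarith
      · gcongr
        have : 0 ≤ (C + 2) * r₀ := by positivity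
        linarith
  set Q := Matrix.toEuclideanLin (U : Matrix (Fin n) (Fin n) ℝ) with hQ
  have hQc : Continuous Q := LinearMap.continuous_of_finiteDimensional Q
  set b : ℝ := ∑ j, |√(m j)| with hb
  have hb0 : 0 ≤ b := Finset.sum_nonneg fun _ _ => abs_nonneg _
  have hmb : ∀ j, |√(m j)| ≤ b := fun j =>
    Finset.single_le_sum (f := fun j => |√(m j)|) (fun _ _ => abs_nonneg _) (Finset.mem_univ j)
  have hδ : ∀ (g : E n → ℝ) y, secondDiff (fun w => g (x + Q w)) 0 y = secondDiff g x (Q y) := by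
    intro g y
    rw [hQ, secondDiff_comp_unitary, map_zero, add_zero]
  have hQn : ∀ y, ‖Q y‖ = ‖y‖ := norm_toEuclideanLin_unitary U
  have hvm : ∀ k, Measurable (v k) := fun k =>
    Measurable.ite Metric.isOpen_ball.measurableSet hψ.continuous.measurable
      hu.continuous.measurable
  have hshift : Measurable fun w => x + Q w := (continuous_const.add hQc).measurable
  refine integrable_of_tendsto_of_le_extIntegral
    (g := stretchIntegrand s (fun w => u (x + Q w)) fun i => √(m i))
    (gs := fun k => stretchIntegrand s (fun w => v k (x + Q w)) fun i => √(m i))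
    (G := fun w => growth (C + 2) L' (b * ‖w‖) / ‖w‖ ^ ((n : ℝ) + 2 * s))
    (measurable_stretchIntegrand s (hu.continuous.measurable.comp hshift) _)
    (fun k => measurable_stretchIntegrand s ((hvm k).comp hshift) _)
    ?_ (integrable_growth_mul hn hs₀ hs₁ (by linarith) hL'0 hb0) (fun k w => ?_)
    (Filter.Eventually.of_forall fun w => ?_) (fun k => ?_)
  · have := (continuous_growth (C + 2) L').measurable
    fun_prop
  · refine stretchIntegrand_le s (by linarith) hL'0 (fun y => ?_) hmb hb0 w
    rw [hδ, ← hQn y]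
    exact hbd k (Q y)
  · refine tendsto_nhds_of_eventually_eq ?_
    set y := Q (stretch (fun i => √(m i)) w) with hy
    have key : ∀ᶠ k in Filter.atTop, secondDiff (v k) x y = secondDiff u x y := by
      -- For `y = 0` both second differences vanish, whatever the radius.
      rcases eq_or_ne y 0 with h0 | h0
      · refine Filter.Eventually.of_forall fun k => ?_
        simp only [h0, secondDiff, add_zero, sub_zero, hvx]
      · filter_upwards [hrlim.eventually_lt_const (norm_pos_iff.2 h0)] with k hk
          using hout k y hk.le
    filter_upwards [key] with k hk
    simp only [stretchIntegrand, hδ, ← hy, hk]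
  · have h1 := hvisc.2 x hx (Metric.ball x (r k)) Metric.isOpen_ball
      (Metric.mem_ball_self (hrpos k)) ((Metric.ball_subset_ball (hrle k)).trans hball) ψ
      hψ.contDiffOn hψx (fun y _ hy => hψu y hy)
    have h2 : fracHessian f Γ s (v k) x ≤ linearOp s (conjDiag U m) (v k) x :=
      iInf₂_le (conjDiag U m) hM
    rw [linearOp_conjDiag s U hm] at h2
    have hs : 0 < 1 - s := by linarith
    have h3 : ((η₀ / (1 - s) : ℝ) : EReal) ≤ fracHessian f Γ s (v k) x := by
      rw [EReal.coe_div, EReal.div_le_iff_le_mul (by exact_mod_cast hs) (EReal.coe_ne_top _)]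
      convert h1 using 4
    exact h3.trans h2

/-! ### Degenerate coefficients -/

/-- If `M ∈ 𝓜` has an eigenvalue `ε`, the mean `R` of the remaining ones is at least `1 / (4 ε)`, and
each of them differs from `R` by at most `3 R ε`. -/
theorem eigenvalues_near_mean_of_constraint {n : ℕ} (hn : 2 ≤ n) {m : Fin n → ℝ}
    (hq : (∑ i, m i) ^ 2 / ((n : ℝ) - 1) - ∑ i, m i ^ 2 = 1 / 2) (hm : ∀ i, 0 < m i)
    (i₀ : Fin n) : ∃ R : ℝ, 0 < R ∧ 1 ≤ 4 * R * m i₀ ∧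
      ∀ i, i ≠ i₀ → |m i - R| ≤ 3 * R * m i₀ := by
  have hN : (0 : ℝ) < (n : ℝ) - 1 := by
    have : (2 : ℝ) ≤ n := by exact_mod_cast hn
    linarith
  have hN1 : (1 : ℝ) ≤ (n : ℝ) - 1 := by
    have : (2 : ℝ) ≤ n := by exact_mod_cast hn
    linarith
  set ε := m i₀ with hε
  set T := Finset.univ.erase i₀ with hT
  have hcard : (T.card : ℝ) = (n : ℝ) - 1 := by
    rw [hT, Finset.card_erase_of_mem (Finset.mem_univ _), Finset.card_univ, Fintype.card_fin,
      Nat.cast_sub (by omega)]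
    simp
  set R := (∑ i ∈ T, m i) / ((n : ℝ) - 1) with hR
  have hRN : ∑ i ∈ T, m i = ((n : ℝ) - 1) * R := by rw [hR]; field_simp
  set Q := ∑ i ∈ T, m i ^ 2 with hQ
  have hvar : ∑ i ∈ T, (m i - R) ^ 2 = Q - ((n : ℝ) - 1) * R ^ 2 := by
    have : ∀ i ∈ T, (m i - R) ^ 2 = m i ^ 2 - 2 * R * m i + R ^ 2 := fun i _ => by ring
    rw [Finset.sum_congr rfl this, Finset.sum_add_distrib, Finset.sum_sub_distrib,
      ← Finset.mul_sum, hRN, Finset.sum_const, nsmul_eq_mul, hcard]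
    ring
  have hne : T.Nonempty := by
    rw [← Finset.card_pos]
    have : (0 : ℝ) < (T.card : ℝ) := by rw [hcard]; exact hN
    exact_mod_cast this
  have hRpos : 0 < R := div_pos (Finset.sum_pos (fun i _ => hm i) hne) hN
  rw [← Finset.add_sum_erase _ _ (Finset.mem_univ i₀), ← Finset.add_sum_erase _ _
    (Finset.mem_univ i₀), ← hT, hRN, ← hQ, ← hε] at hq
  have hq' : Q - ((n : ℝ) - 1) * R ^ 2 = 2 * R * ε + ε ^ 2 / ((n : ℝ) - 1) - ε ^ 2 - 1 / 2 := by
    have : (ε + ((n : ℝ) - 1) * R) ^ 2 / ((n : ℝ) - 1) =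
        ε ^ 2 / ((n : ℝ) - 1) + 2 * R * ε + ((n : ℝ) - 1) * R ^ 2 := by
      field_simp
      ring
    linarith
  have hε2 : ε ^ 2 / ((n : ℝ) - 1) ≤ ε ^ 2 := div_le_self (sq_nonneg ε) hN1
  have hvar0 : 0 ≤ ∑ i ∈ T, (m i - R) ^ 2 := Finset.sum_nonneg fun _ _ => sq_nonneg _
  have h1 : 1 ≤ 4 * R * ε := by linarith
  refine ⟨R, hRpos, h1, fun i hi => ?_⟩
  have h2 : (m i - R) ^ 2 ≤ 2 * R * ε := by
    have := Finset.single_le_sum (f := fun i => (m i - R) ^ 2) (fun _ _ => sq_nonneg _)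
      (Finset.mem_erase.2 ⟨hi, Finset.mem_univ i⟩)
    linarith
  -- As `1 ≤ 4 R ε`, the bound `2 R ε` is at most `8 (R ε)² ≤ (3 R ε)²`.
  refine abs_le_of_sq_le_sq ?_ (by have := hm i₀; positivity)
  nlinarith

/-- The eigenvalues `(R, …, R, ε)` satisfy the equation defining `𝓜` under this relation between `R` and `ε`. -/
theorem constraint_update {n : ℕ} (hn : 2 ≤ n) (i₀ : Fin n) {ε R : ℝ}
    (h : 2 * R * ε + ε ^ 2 / ((n : ℝ) - 1) - ε ^ 2 = 1 / 2) :
    (∑ i, Function.update (fun _ : Fin n => R) i₀ ε i) ^ 2 / ((n : ℝ) - 1) -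
      ∑ i, Function.update (fun _ : Fin n => R) i₀ ε i ^ 2 = 1 / 2 := by
  have hN : (n : ℝ) - 1 ≠ 0 := by
    have : (2 : ℝ) ≤ n := by exact_mod_cast hn
    exact (by linarith : (0 : ℝ) < (n : ℝ) - 1).ne'
  have hsum : ∀ φ : ℝ → ℝ, ∑ i, φ (Function.update (fun _ : Fin n => R) i₀ ε i) =
      φ ε + ((n : ℝ) - 1) * φ R := by
    intro φ
    have h1 : ∀ i ∈ Finset.univ.erase i₀,
        φ (Function.update (fun _ : Fin n => R) i₀ ε i) = φ R := by
      intro i hi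
      rw [Function.update_of_ne (Finset.ne_of_mem_erase hi)]
    rw [← Finset.add_sum_erase _ _ (Finset.mem_univ i₀), Finset.sum_congr rfl h1,
      Finset.sum_const, Finset.card_erase_of_mem (Finset.mem_univ _), Finset.card_univ,
      Fintype.card_fin, nsmul_eq_mul, Nat.cast_sub (by omega), Function.update_self]
    simp
  have h1 := hsum fun t => t
  have h2 := hsum fun t => t ^ 2
  rw [h1, h2, ← h]
  field_simp
  ring

/-- All smallness conditions on `θ` hold for some `θ > 0`, since they hold as `θ → 0⁺`. -/
theorem exists_threshold {s : ℝ} (hs : 0 < s) (C₀ N R₁ ε₁ η K : ℝ) (hR₁ : 0 < R₁) (hε₁ : 0 < ε₁)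
    (hη : 0 < η) : ∃ θ : ℝ, 0 < θ ∧ θ ^ 2 * (4 * R₁) ≤ ε₁ ∧
      C₀ * (N * (8 * θ * R₁) ^ s) ≤ η / 4 ∧ K ≤ (1 / (4 * θ * R₁)) ^ s * (η / 4) := by
  have h0 : Filter.Tendsto (fun θ : ℝ => θ ^ 2 * (4 * R₁)) (nhdsWithin 0 (Set.Ioi 0)) (nhds 0) := by
    have : Continuous fun θ : ℝ => θ ^ 2 * (4 * R₁) := by fun_prop
    simpa using (this.tendsto 0).mono_left nhdsWithin_le_nhds
  have h1 : Filter.Tendsto (fun θ : ℝ => C₀ * (N * (8 * θ * R₁) ^ s))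
      (nhdsWithin 0 (Set.Ioi 0)) (nhds 0) := by
    have : Continuous fun θ : ℝ => C₀ * (N * (8 * θ * R₁) ^ s) := by
      have := Real.continuous_rpow_const hs.le
      fun_prop
    simpa [Real.zero_rpow hs.ne'] using (this.tendsto 0).mono_left nhdsWithin_le_nhds
  have h2 : Filter.Tendsto (fun θ : ℝ => (1 / (4 * θ * R₁)) ^ s * (η / 4))
      (nhdsWithin 0 (Set.Ioi 0)) Filter.atTop := by
    refine Filter.Tendsto.atTop_mul_const (by linarith) ((tendsto_rpow_atTop hs).comp ?_)
    have := (tendsto_inv_nhdsGT_zero (𝕜 := ℝ)).const_mul_atTop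
      (show 0 < (4 * R₁)⁻¹ by positivity)
    refine this.congr fun θ => ?_
    rw [one_div, ← mul_inv]
    congr 1; ring
  have := ((h0.eventually_le_const hε₁).and ((h1.eventually_le_const
    (show 0 < η / 4 by linarith)).and (h2.eventually_ge_atTop K))).and self_mem_nhdsWithin
  obtain ⟨θ, ⟨ha, hb, hc⟩, hθ⟩ := this.exists
  exact ⟨θ, hθ, ha, hb, hc⟩

/-- If all operators of the family, in a fixed eigenbasis, are at least `η > 0`, then those with an
eigenvalue below some `θ > 0` exceed any prescribed `K`. The choice of `θ` does not depend on the
function. -/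
theorem exists_degenerate_threshold {n : ℕ} (hn : 2 ≤ n) {s : ℝ} (hs₀ : 1 / 2 < s) (hs₁ : s < 1)
    {η : ℝ} (hη : 0 < η) (L : ℝ≥0) {C : ℝ} (hC : 0 ≤ C) (K : ℝ) :
    ∃ θ : ℝ, 0 < θ ∧ ∀ v : E n → ℝ, LipschitzWith L v →
      (∀ x y, secondDiff v x y ≤ C * ‖y‖ ^ 2) →
      (∀ m : Fin n → ℝ, (∀ i, 0 < m i) →
        (∑ i, m i) ^ 2 / ((n : ℝ) - 1) - ∑ i, m i ^ 2 = 1 / 2 →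
        Integrable (stretchIntegrand s v fun i => √(m i)) ∧
          η ≤ ∫ w, stretchIntegrand s v (fun i => √(m i)) w) →
      ∀ m : Fin n → ℝ, (∀ i, 0 < m i) →
        (∑ i, m i) ^ 2 / ((n : ℝ) - 1) - ∑ i, m i ^ 2 = 1 / 2 → (∃ i, m i < θ) →
        K ≤ ∫ w, stretchIntegrand s v (fun i => √(m i)) w := by
  have hs : 0 < s := by linarith
  have hN1 : (1 : ℝ) ≤ (n : ℝ) - 1 := by
    have : (2 : ℝ) ≤ n := by exact_mod_cast hn
    linarith
  have hC₀ : 0 ≤ growthConst n s C L := growthConst_nonneg hC L.2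
  set C₀ := growthConst n s C L with hC₀def
  obtain ⟨ε₁, hε₁, hε₁C⟩ : ∃ ε₁ : ℝ, 0 < ε₁ ∧ C₀ * ε₁ ^ s ≤ η / 2 := by
    refine ⟨(η / (2 * (C₀ + 1))) ^ s⁻¹, by positivity, ?_⟩
    rw [Real.rpow_inv_rpow (by positivity) hs.ne', mul_div_assoc', div_le_div_iff₀ (by positivity)
      two_pos]
    nlinarith
  set R₁ : ℝ := (1 / 2 + (ε₁ ^ 2 - ε₁ ^ 2 / ((n : ℝ) - 1))) / (2 * ε₁) with hR₁def
  have hR₁ : 0 < R₁ := by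
    have : ε₁ ^ 2 / ((n : ℝ) - 1) ≤ ε₁ ^ 2 := div_le_self (sq_nonneg _) hN1
    exact div_pos (by linarith) (by linarith)
  have hR₁ε₁ : 2 * R₁ * ε₁ + ε₁ ^ 2 / ((n : ℝ) - 1) - ε₁ ^ 2 = 1 / 2 := by
    have : 2 * R₁ * ε₁ = 1 / 2 + (ε₁ ^ 2 - ε₁ ^ 2 / ((n : ℝ) - 1)) := by
      rw [hR₁def]; field_simp
    linarith
  obtain ⟨θ, hθ, hθε₁, hθC, hθK⟩ := exists_threshold hs C₀ n R₁ ε₁ η K hR₁ hε₁ hη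
  refine ⟨θ, hθ, fun v hv hsc hell m hm hq ⟨i₀, hi₀⟩ => ?_⟩
  obtain ⟨R, hR, hRε, hmR⟩ := eigenvalues_near_mean_of_constraint hn hq hm i₀
  set ε := m i₀ with hε
  have hεpos : 0 < ε := hm i₀
  set b := R + 3 * R * ε with hb
  have hRb : R ≤ b := by
    have : 0 ≤ 3 * R * ε := by positivity
    linarith
  -- The vector `c (R₁, …, R₁, ε₁)` dominates `m` since `c R₁ = b` bounds all `m i` with `i ≠ i₀`.
  set c := b / R₁ with hc
  have hbpos : 0 < b := hR.trans_le hRb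
  have hcpos : 0 < c := div_pos hbpos hR₁
  have hcR₁ : c * R₁ = b := by rw [hc]; field_simp
  set r : Fin n → ℝ := Function.update (fun _ => R₁) i₀ ε₁ with hr
  have hrpos : ∀ i, 0 < r i := by
    intro i
    rcases eq_or_ne i i₀ with rfl | hi
    · simpa [hr] using hε₁
    · simpa [hr, hi] using hR₁
  have hclow : 1 / (4 * θ * R₁) ≤ c := by
    rw [hc, div_le_div_iff₀ (by positivity) hR₁]
    have h1 : 4 * R * ε ≤ 4 * b * θ := by gcongr
    nlinarith
  have hεc : ε ≤ c * ε₁ := by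
    have h1 : ε * (4 * θ * R₁) ≤ ε₁ := by
      have : ε * (4 * θ * R₁) ≤ θ * (4 * θ * R₁) := by gcongr
      linarith
    have h2 : ε ≤ 1 / (4 * θ * R₁) * ε₁ := by
      rw [one_div_mul_eq_div, le_div_iff₀ (by positivity)]
      exact h1
    exact h2.trans (by gcongr)
  have hmle : ∀ i, m i ≤ c * r i := by
    intro i
    rcases eq_or_ne i i₀ with rfl | hi
    · simpa [hr] using hεc
    · have := (abs_le.1 (hmR i hi)).2
      simp only [hr, Function.update_of_ne hi, hcR₁, hb]
      linarith
  obtain ⟨hrint, hrη⟩ := hell r hrpos (constraint_update hn i₀ hR₁ε₁)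
  have hsc' := integrable_stretchIntegrand_mul (Real.sqrt_pos.2 hcpos) hrint
  have hcomp := (integral_stretchIntegrand_le (by omega) hs₀ hs₁ hC hv hsc
    (a := fun i => √(m i)) (b := fun i => √c * √(r i)) (fun i => Real.sqrt_nonneg _)
    (fun i => by rw [← Real.sqrt_mul hcpos.le]; exact Real.sqrt_le_sqrt (hmle i)) hsc').2
  rw [integral_stretchIntegrand_mul (Real.sqrt_pos.2 hcpos), Real.sqrt_eq_rpow c,
    ← Real.rpow_mul hcpos.le, show 1 / 2 * (2 * s) = s by ring, ← Real.sqrt_eq_rpow] at hcomp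
  have hcs : 0 < c ^ s := Real.rpow_pos_of_pos hcpos s
  have hterm : ∀ i, ((√c * √(r i)) ^ 2 - √(m i) ^ 2) ^ s ≤
      c ^ s * (if i = i₀ then ε₁ ^ s else (8 * θ * R₁) ^ s) := by
    intro i
    rw [mul_pow, Real.sq_sqrt hcpos.le, Real.sq_sqrt (hrpos i).le, Real.sq_sqrt (hm i).le]
    have h0 : 0 ≤ c * r i - m i := sub_nonneg.2 (hmle i)
    split_ifs with hi
    · rw [← Real.mul_rpow hcpos.le hε₁.le]
      refine Real.rpow_le_rpow h0 ?_ hs.le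
      have := hm i
      rw [hi] at this ⊢
      simp only [hr, Function.update_self]
      linarith
    · rw [← Real.mul_rpow hcpos.le (by positivity)]
      refine Real.rpow_le_rpow h0 ?_ hs.le
      have h1 := (abs_le.1 (hmR i hi)).1
      have h2 : R * ε ≤ b * θ := by gcongr
      simp only [hr, Function.update_of_ne hi]
      have h3 : c * (8 * θ * R₁) = 8 * (b * θ) := by rw [← hcR₁]; ring
      have h4 : 0 ≤ b * θ := by positivity
      rw [h3, hcR₁, hb]
      linarith
  have hsum : ∑ i, ((√c * √(r i)) ^ 2 - √(m i) ^ 2) ^ s ≤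
      c ^ s * (ε₁ ^ s + n * (8 * θ * R₁) ^ s) := by
    refine (Finset.sum_le_sum fun i _ => hterm i).trans ?_
    rw [← Finset.mul_sum]
    refine mul_le_mul_of_nonneg_left ?_ hcs.le
    have h8 : 0 ≤ (8 * θ * R₁) ^ s := by positivity
    have hε₁s : 0 ≤ ε₁ ^ s := by positivity
    calc ∑ i, (if i = i₀ then ε₁ ^ s else (8 * θ * R₁) ^ s)
        ≤ ∑ i, ((if i = i₀ then ε₁ ^ s else 0) + (8 * θ * R₁) ^ s) := by
          refine Finset.sum_le_sum fun i _ => ?_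
          split_ifs <;> linarith
      _ = _ := by simp [Finset.sum_add_distrib]
  have hfin : c ^ s * (η / 4) ≤ ∫ w, stretchIntegrand s v (fun i => √(m i)) w := by
    have h1 := mul_le_mul_of_nonneg_right hsum hC₀
    have h2 := mul_le_mul_of_nonneg_left hrη hcs.le
    have h3 : C₀ * (ε₁ ^ s + n * (8 * θ * R₁) ^ s) ≤ 3 * η / 4 := by linarith
    have h4 := mul_le_mul_of_nonneg_left h3 hcs.le
    linarith
  refine hθK.trans (le_trans ?_ hfin)
  gcongr

end FracHessian

end

theorem theorem1p4 (n : ℕ) (hn : 2 ≤ n) (s : ℝ) (hs₀ : 1 / 2 < s) (hs₁ : s < 1)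
    (η₀ : ℝ) (hη₀ : 0 < η₀) (L : ℝ≥0) (SC : ℝ) :
    ∃ θ : ℝ, 0 < θ ∧
      ∀ (Ω : Set (FracHessian.E n)) (u : FracHessian.E n → ℝ),
        IsOpen Ω →
        LipschitzWith L u →
        FracHessian.IsSemiconcaveOn Set.univ SC u →
        FracHessian.IsViscositySubsolution
          (fun v x => ((1 - s : ℝ) : EReal) *
            FracHessian.fracHessian (FracHessian.sigmaRoot n 2) (FracHessian.GammaCone n 2) s v x)
          (fun _ => η₀) Ω u →
        ∀ x ∈ Ω,
          FracHessian.fracHessian (FracHessian.sigmaRoot n 2) (FracHessian.GammaCone n 2) s u x =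
            FracHessian.fracHessianElliptic (FracHessian.sigmaRoot n 2) (FracHessian.GammaCone n 2)
              s θ u x := by
  open FracHessian in
  rcases lt_or_ge SC 0 with hSC | hSC
  · exact ⟨1, one_pos, fun Ω u _ _ hsc => absurd hsc.2.1 hSC.not_ge⟩
  have hn0 : 0 < n := by omega
  have hn2 : (2 : ℝ) ≤ n := by exact_mod_cast hn
  have hN : 0 < (n : ℝ) - 1 := by linarith
  -- The multiple `a I` of the identity that belongs to `𝓜` serves as the competitor.
  set a : ℝ := √(((n : ℝ) - 1) / (2 * n)) with ha
  have hapos : 0 < a := Real.sqrt_pos.2 (div_pos hN (by linarith))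
  have hmem : conjDiag (1 : Matrix.unitaryGroup (Fin n) ℝ) (fun _ => a) ∈
      coeffSet (sigmaRoot n 2) (GammaCone n 2) := by
    refine conjDiag_mem_coeffSet hn 1 (fun _ => hapos) ?_
    have ha2 : a ^ 2 = ((n : ℝ) - 1) / (2 * n) := Real.sq_sqrt (div_nonneg hN.le (by linarith))
    simp only [Finset.sum_const, Finset.card_univ, Fintype.card_fin, nsmul_eq_mul, mul_pow, ha2]
    field_simp
    ring
  have hη : 0 < η₀ / (1 - s) := div_pos hη₀ (by linarith)
  obtain ⟨θ, hθ, hdeg⟩ := exists_degenerate_threshold hn hs₀ hs₁ hη L hSC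
    (√a ^ (2 * s) * growthConst n s SC L)
  refine ⟨min θ a, lt_min hθ hapos, fun Ω u hΩ hu hsc hvisc x hx => ?_⟩
  have hsc' : ∀ x y, secondDiff u x y ≤ SC * ‖y‖ ^ 2 := fun x y => hsc.2.2 x y (Set.subset_univ _)
  have hsc'' : ∀ (U : Matrix.unitaryGroup (Fin n) ℝ) (z y : E n), secondDiff
      (fun w => u (x + Matrix.toEuclideanLin (U : Matrix (Fin n) (Fin n) ℝ) w)) z y ≤
        SC * ‖y‖ ^ 2 := by
    intro U z y
    rw [secondDiff_comp_unitary]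
    exact (hsc' _ _).trans_eq (by rw [norm_toEuclideanLin_unitary])
  have href : fracHessianElliptic (sigmaRoot n 2) (GammaCone n 2) s (min θ a) u x ≤
      ((√a ^ (2 * s) * growthConst n s SC L : ℝ) : EReal) := by
    have hmin : min θ a ≤ lambdaMin (conjDiag (1 : Matrix.unitaryGroup (Fin n) ℝ) fun _ => a) := by
      rw [lambdaMin_conjDiag_const hn0 1 hapos]
      exact min_le_right _ _
    refine (iInf₂_le (conjDiag 1 fun _ => a) ⟨hmem, hmin⟩).trans ?_
    · rw [linearOp_conjDiag s 1 fun _ => hapos, ← integral_growth_mul hs₀ (Real.sqrt_nonneg a)]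
      refine extIntegral_le (integrable_growth_mul hn0 hs₀ hs₁ hSC L.2 (Real.sqrt_nonneg a))
        (fun w => div_nonneg (growth_nonneg hSC L.2 (by positivity)) (by positivity)) fun w => ?_
      refine stretchIntegrand_le s hSC L.2 (fun y => ?_)
        (fun _ => (abs_of_nonneg (Real.sqrt_nonneg a)).le) (Real.sqrt_nonneg a) w
      exact secondDiff_le_growth (lipschitzWith_comp_unitary 1 hu x) (hsc'' 1) 0 y
  refine le_antisymm (le_iInf₂ fun M hM => iInf₂_le M hM.1) (le_iInf₂ fun M hM => ?_)
  rcases le_or_gt (min θ a) (lambdaMin M) with hle | hlt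
  · exact iInf₂_le M ⟨hM, hle⟩
  obtain ⟨U, hMU, hpos, hq⟩ := exists_conjDiag_of_mem_coeffSet hn hM
  have hge : ∀ m : Fin n → ℝ, (∀ i, 0 < m i) →
      (∑ i, m i) ^ 2 / ((n : ℝ) - 1) - ∑ i, m i ^ 2 = 1 / 2 → _ := fun m hm hqm =>
    integral_stretchIntegrand_ge_of_viscosity hn0 hs₀ hs₁ hSC hΩ hu hsc' hvisc hx U hm
      (conjDiag_mem_coeffSet hn U hm hqm)
  have : Nonempty (Fin n) := ⟨⟨0, hn0⟩⟩
  obtain ⟨i, hi⟩ := exists_lt_of_ciInf_lt hlt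
  have hK := hdeg _ (lipschitzWith_comp_unitary U hu x) (hsc'' U) hge _ hpos hq
    ⟨i, hi.trans_le (min_le_left _ _)⟩
  refine href.trans ?_
  rw [hMU, linearOp_conjDiag s U hpos, extIntegral_eq_integral (hge _ hpos hq).1]
  exact_mod_cast hK
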